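/- Consider three points $z_i=(x_i^\mu,\theta_i^\alpha,\bar\theta_i^{\dot\alpha})$, $i=1,2,3$, of four-dimensional $\mathcal N=1$ superspace, with metric $(+,-,-,-)$ and $\sigma^\mu=(1,\vec\sigma)$. Let $$D_i=\frac{\partial}{\partial\theta_i}-\mathrm i\,\sigma^\mu\bar\theta_i\,\frac{\partial}{\partial x_i^\mu},\qquad \bar D_i=-\frac{\partial}{\partial\bar\theta_i}+\mathrm i\,\theta_i\sigma^\mu\,\frac{\partial}{\partial x_i^\mu}$$ be the covariant derivatives (left derivatives in the odd variables), $x_{i\pm}^\mu=x_i^\mu\mp\mathrm i\,\theta_i\sigma^\mu\bar\theta_i$, and $$x_{\bar ij}^\mu=x_{i-}^\mu-x_{j+}^\mu-2\mathrm i\,\theta_j\sigma^\mu\bar\theta_i .$$ Superfields are functions of the $x_i$ with values in the complex Grassmann algebra on the twelve variables $\theta_i^\alpha,\bar\theta_i^{\dot\alpha}$. Let $$J_1=\frac{X_{1+}^2}{X_{1-}^2},\qquad X_{1+}^2=\frac{x_{\bar23}^2}{x_{\bar21}^2x_{\bar13}^2},\qquad X_{1-}^2=\frac{x_{\bar32}^2}{x_{\bar31}^2x_{\bar12}^2},\qquad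 I_{3PF}=J_1-1,$$ where $I_{3PF}$ is the nilpotent three-point invariant. Let $\eta_i,\kappa_i\in\mathbb R$ (scale dimensions and R-charges) with $\kappa_1+\kappa_2+\kappa_3=0$, and put $$\Delta_{lm}=-\tfrac14\sum_{i=1}^3\eta_i+\tfrac12(\eta_l+\eta_m)+\tfrac12(\kappa_l-\kappa_m).$$ Let $U\subset(\mathbb R^4)^3$ be non-empty and open, with all $(x_i-x_j)^2\neq0$ ($i\ne j$) on $U$, and fix on $U$ continuous branches, symmetric in $i,j$, of $\log (x_i-x_j)^2$. Complex powers of the even superfields $x_{\bar ij}^2$ are defined with these branches by Taylor expansion in the nilpotent part, and powers of $I_{3PF}+1$ by the binomial series. Let $f_{3PF}$ be an arbitrary function of one variable, given by its Taylor series at $0$ with complex coefficients, and let $$G=\frac{f_{3PF}(I_{3PF})}{\prod_{l\neq m}(x_{\bar lm}^2)^{\Delta_{lm}}}$$ be the general scalar three-point function. 1. If the charges are those of one anti-chiral and two chiral scalar superfields, $\kappa_1=\tfrac13\eta_1$, $\kappa_2=-\tfrac13\eta_2$, $\kappa_3=-\tfrac13\eta_3$, then $\eta_1=\eta_2+\eta_3$.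 2. $G$ satisfies the chirality constraints $D_1G=0$, $\bar D_2G=0$, $\bar D_3G=0$ on $U$ if and only if there is a constant $C\in\mathbb C$ such that on $U$ $$f_{3PF}(I_{3PF})=C\,(I_{3PF}+1)^{-\Delta_{21}}\qquad\text{and}\qquad G=\frac{C}{(x_{\bar12}^2)^{\eta_2}\,(x_{\bar13}^2)^{\eta_3}},$$ and such that, if $C\neq0$, then $\kappa_1=\tfrac13\eta_1$, $\kappa_2=-\tfrac13\eta_2$, $\kappa_3=-\tfrac13\eta_3$ (hence, by 1, $\eta_1=\eta_2+\eta_3$). -/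

import Mathlib

noncomputable section

namespace ThreePointSCFT

/-! ## The Grassmann algebra of three copies of N = 1 superspace -/

/-- Labels of the twelve Grassmann coordinates of three points in superspace: `inl (i, a)` labels
the component `a` of `θ_i`, and `inr (i, b)` labels the component `b` of `θbar_i`.
The points `1, 2, 3` are indexed by `0, 1, 2 : Fin 3`. -/
abbrev Gen : Type := (Fin 3 × Fin 2) ⊕ (Fin 3 × Fin 2)

/-- The complex Grassmann algebra on the twelve odd coordinates. -/
abbrev Grassmann : Type := ExteriorAlgebra ℂ (Gen → ℂ)

/-- The monomial basis of the Grassmann algebra, for some ordering of the twelve generators. -/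
def monomialBasis : Module.Basis (Finset (Fin (Fintype.card Gen))) ℂ Grassmann :=
  Module.Basis.ExteriorAlgebra ((Pi.basisFun ℂ Gen).reindex (Fintype.equivFin Gen))

/-- The Grassmann algebra is finite-dimensional; it is normed through its coordinates. The norm
serves only to differentiate with respect to the real coordinates, so its choice is immaterial. -/
instance : NormedAddCommGroup Grassmann :=
  NormedAddCommGroup.induced Grassmann (Finset (Fin (Fintype.card Gen)) → ℂ)
    monomialBasis.equivFun monomialBasis.equivFun.injective

instance : NormedSpace ℂ Grassmann :=
  NormedSpace.induced ℂ Grassmann (Finset (Fin (Fintype.card Gen)) → ℂ) monomialBasis.equivFun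

/-- The odd coordinate `θ_i^a`. -/
def θ (i : Fin 3) (a : Fin 2) : Grassmann := ExteriorAlgebra.ι ℂ (Pi.single (Sum.inl (i, a)) 1)

/-- The odd coordinate `θbar_i^b`. -/
def θbar (i : Fin 3) (b : Fin 2) : Grassmann :=
  ExteriorAlgebra.ι ℂ (Pi.single (Sum.inr (i, b)) 1)

/-- The left derivative of the Grassmann algebra with respect to an odd coordinate: the
antiderivation that maps this coordinate to `1` and the other ones to `0`. -/
def oddDeriv (g : Gen) : Grassmann →ₗ[ℂ] Grassmann :=
  CliffordAlgebra.contractLeft (LinearMap.proj g : Module.Dual ℂ (Gen → ℂ))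

/-- The value `f(N) = ∑ k, f_k N ^ k` of a function `f` with Taylor series `∑ k, f_k X ^ k` at `0`
on an element `N` without constant term. The powers of such an `N` beyond the number of odd
coordinates vanish, so the sum is the whole Taylor series. -/
def taylorEval (f : PowerSeries ℂ) (N : Grassmann) : Grassmann :=
  ∑ k ∈ Finset.range (Fintype.card Gen + 1), PowerSeries.coeff k f • N ^ k

/-- The complex power `Φ ^ a` of an even element whose constant term is `exp L`, with respect to
the value `L` of the logarithm of the constant term:
`exp (a L) * ∑ k, (a choose k) (exp (-L) Φ - 1) ^ k`. -/
def gpow (L a : ℂ) (Φ : Grassmann) : Grassmann :=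
  Complex.exp (a * L) •
    taylorEval (PowerSeries.binomialSeries ℂ a) (Complex.exp (-L) • Φ - 1)

/-! ## Superfields, covariant derivatives and intervals -/

/-- The real coordinates `x_i^μ` of three points. -/
abbrev Config : Type := Fin 3 → Fin 4 → ℝ

/-- Functions of three points of superspace, through their expansion in the odd coordinates. -/
abbrev Superfield : Type := Config → Grassmann

/-- The Pauli matrices `σ^μ = (1, σ₁, σ₂, σ₃)`. -/
def pauli : Fin 4 → Matrix (Fin 2) (Fin 2) ℂ :=
  ![!![1, 0; 0, 1], !![0, 1; 1, 0], !![0, -Complex.I; Complex.I, 0], !![1, 0; 0, -1]]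

/-- The diagonal of the Minkowski metric, of signature `(+, -, -, -)`. -/
def minkowski : Fin 4 → ℂ := ![1, -1, -1, -1]

/-- The bilinear `θ_j σ^μ θbar_i`. -/
def bilin (j i : Fin 3) (μ : Fin 4) : Grassmann :=
  ∑ a, ∑ b, pauli μ a b • (θ j a * θbar i b)

/-- The derivative `∂/∂x_i^μ`. -/
def evenDeriv (i : Fin 3) (μ : Fin 4) (Φ : Superfield) : Superfield := fun x =>
  fderiv ℝ Φ x (Pi.single i (Pi.single μ 1))

/-- The covariant derivative `D = ∂/∂θ - i σ^μ θbar ∂/∂x^μ` at the point `i`. -/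
def covD (i : Fin 3) (a : Fin 2) (Φ : Superfield) : Superfield := fun x =>
  oddDeriv (Sum.inl (i, a)) (Φ x) -
    Complex.I • ∑ μ, ∑ b, pauli μ a b • (θbar i b * evenDeriv i μ Φ x)

/-- The covariant derivative `Dbar = -∂/∂θbar + i θ σ^μ ∂/∂x^μ` at the point `i`. -/
def covDbar (i : Fin 3) (b : Fin 2) (Φ : Superfield) : Superfield := fun x =>
  -oddDeriv (Sum.inr (i, b)) (Φ x) +
    Complex.I • ∑ μ, ∑ a, pauli μ a b • (θ i a * evenDeriv i μ Φ x)

/-- The chiral coordinate `x_{i+} = x_i - i θ_i σ θbar_i`. -/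
def xPlus (i : Fin 3) (μ : Fin 4) : Superfield := fun x =>
  algebraMap ℂ Grassmann (x i μ : ℂ) - Complex.I • bilin i i μ

/-- The anti-chiral coordinate `x_{i-} = x_i + i θ_i σ θbar_i`. -/
def xMinus (i : Fin 3) (μ : Fin 4) : Superfield := fun x =>
  algebraMap ℂ Grassmann (x i μ : ℂ) + Complex.I • bilin i i μ

/-- The interval `x_{ībar j} = x_{i-} - x_{j+} - 2 i θ_j σ θbar_i`. -/
def interval (i j : Fin 3) (μ : Fin 4) : Superfield := fun x =>
  xMinus i μ x - xPlus j μ x - (2 * Complex.I) • bilin j i μ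

/-- The Minkowski square `(x_{ībar j})²` of the interval. -/
def intervalSq (i j : Fin 3) : Superfield := fun x =>
  ∑ μ, minkowski μ • (interval i j μ x * interval i j μ x)

/-- The Minkowski square `(x_i - x_j)²` for vanishing odd coordinates. -/
def bodySq (i j : Fin 3) (x : Config) : ℂ :=
  ∑ μ, minkowski μ * ((x i μ - x j μ : ℝ) : ℂ) ^ 2

/-! ## The three-point invariant and the three-point function -/

/-- `X_{1+}² = x_{2bar 3}² / (x_{2bar 1}² x_{1bar 3}²)`. -/
def X1PlusSq : Superfield := fun x =>
  intervalSq 1 2 x * Ring.inverse (intervalSq 1 0 x * intervalSq 0 2 x)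

/-- `X_{1-}² = x_{3bar 2}² / (x_{3bar 1}² x_{1bar 2}²)`. -/
def X1MinusSq : Superfield := fun x =>
  intervalSq 2 1 x * Ring.inverse (intervalSq 2 0 x * intervalSq 0 1 x)

/-- `J_1 = X_{1+}² / X_{1-}²`. -/
def J1 : Superfield := fun x => X1PlusSq x * Ring.inverse (X1MinusSq x)

/-- The nilpotent three-point invariant `I_{3PF} = J_1 - 1`. -/
def I3PF : Superfield := fun x => J1 x - 1

/-- A choice, on the set `U` of configurations, of the logarithms of the three squares
`(x_i - x_j)²` (so that none of them vanishes on `U`), continuous and symmetric in `i, j`.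
It fixes the branch of the powers. -/
structure IsLogBranch (U : Set Config) (ℓ : Fin 3 → Fin 3 → Config → ℂ) : Prop where
  continuousOn : ∀ i j, i ≠ j → ContinuousOn (ℓ i j) U
  symm : ∀ i j, i ≠ j → ∀ x ∈ U, ℓ i j x = ℓ j i x
  exp_eq : ∀ i j, i ≠ j → ∀ x ∈ U, Complex.exp (ℓ i j x) = bodySq i j x

/-- The power `(x_{ībar j}²) ^ a`. -/
def intervalPow (ℓ : Fin 3 → Fin 3 → Config → ℂ) (i j : Fin 3) (a : ℂ) : Superfield := fun x =>
  gpow (ℓ i j x) a (intervalSq i j x)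

/-- The exponent `Δ_{lm}` of the `3`-point function of scalar superfields with scale dimensions
`η_i` and R-charges `κ_i`. -/
def Δ (η κ : Fin 3 → ℝ) (l m : Fin 3) : ℝ :=
  -(1 / 4) * ∑ i, η i + (1 / 2) * (η l + η m) + (1 / 2) * (κ l - κ m)

/-- The general scalar three-point function `f(I_{3PF}) / ∏_{l ≠ m} (x_{lbar m}²) ^ Δ_{lm}`. -/
def generalThreePoint (ℓ : Fin 3 → Fin 3 → Config → ℂ) (η κ : Fin 3 → ℝ) (f : PowerSeries ℂ) :
    Superfield := fun x =>
  taylorEval f (I3PF x) * Ring.inverse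
    (intervalPow ℓ 0 1 (Δ η κ 0 1) x * intervalPow ℓ 1 0 (Δ η κ 1 0) x *
     intervalPow ℓ 0 2 (Δ η κ 0 2) x * intervalPow ℓ 2 0 (Δ η κ 2 0) x *
     intervalPow ℓ 1 2 (Δ η κ 1 2) x * intervalPow ℓ 2 1 (Δ η κ 2 1) x)

/-- The function `1 / ((x_{1bar 2}²) ^ η₂ (x_{1bar 3}²) ^ η₃)`. -/
def chiralThreePoint (ℓ : Fin 3 → Fin 3 → Config → ℂ) (η : Fin 3 → ℝ) : Superfield := fun x =>
  Ring.inverse (intervalPow ℓ 0 1 (η 1) x * intervalPow ℓ 0 2 (η 2) x)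

/-- The chirality constraints on `U` for an anti-chiral field at the first point and chiral
fields at the second and the third point. -/
def IsChiralOn (U : Set Config) (G : Superfield) : Prop :=
  ∀ x ∈ U, ∀ s : Fin 2, covD 0 s G x = 0 ∧ covDbar 1 s G x = 0 ∧ covDbar 2 s G x = 0

/-- The relation `κ = ± η / 3` between R-charge and scale dimension, with `+` for the anti-chiral
field and `-` for the two chiral fields. -/
def ChiralCharges (η κ : Fin 3 → ℝ) : Prop :=
  κ 0 = η 0 / 3 ∧ κ 1 = -(η 1 / 3) ∧ κ 2 = -(η 2 / 3)

end ThreePointSCFT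

end

/-! All superfields involved are even, hence central in the Grassmann algebra, so the algebra takes
place in the commutative ring `Center`. Points are indexed by 0, 1, 2 below, and `f₀`, `f₁`, `f₂`
are the first Taylor coefficients of `f`.

Two facts carry the forward direction. The first is that the cube of `I3PF` vanishes
(`IsLogAt.centralJ_sub_one_cube`), so that only `f₀`, `f₁`, `f₂` matter. Modulo the left ideal
generated by the two components of one odd spinor `δ`, the numerator and the denominator of `J1`
agree, and a central element of such an ideal has vanishing cube.

The second is that `f₀`, `f₁`, `f₂` can be read off at a single configuration. A linear substitution
of the odd coordinates that kills `θbar_i` turns `D_i` into the plain derivative in `θ_i`, and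
likewise for `Dbar_i`. Three substitutions are chosen so that each square becomes its body times `1
+ ε` with `ε ^ 2 = 0`. The constraints then give `f₁ = Δ₂₀ f₀ = -Δ₁₀ f₀` and `2 f₂ = (Δ₂₀ - 1) f₁`
(`antichiral_coeffs`), and `f₁ = Δ₁₂ f₀ = -Δ₂₁ f₀` (`chiral_coeffs`).

These are the binomial coefficients of the exponent `-Δ₁₀`, so `f (I3PF) = f₀ J1 ^ (-Δ₁₀)`. If `f₀ ≠
0`, the four exponents agree up to sign, which together with `∑ κ = 0` forces the chiral charges.
Expanding the power of `J1` then cancels every square except those of the intervals `(0, 1)` and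
`(0, 2)`.

Conversely, these two intervals are annihilated by `D_0`, `Dbar_1`, `Dbar_2`, and so are the complex
powers of their squares (`HasSuperDeriv.complexPow`). -/

noncomputable section

namespace ThreePointSCFT

/-! ## Truncated Taylor series and complex powers in a commutative algebra -/

section Series

variable {A : Type*} [CommRing A] [Algebra ℂ A]

/-- The Taylor series of `f`, truncated after the twelfth power, in an arbitrary algebra. -/
def taylorSum {A : Type*} [Ring A] [Algebra ℂ A] (f : PowerSeries ℂ) (N : A) : A :=
  ∑ k ∈ Finset.range 13, PowerSeries.coeff k f • N ^ k

/-- The complex power of an element with constant term `exp L`, in an arbitrary algebra. -/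
def complexPow {A : Type*} [Ring A] [Algebra ℂ A] (L a : ℂ) (Φ : A) : A :=
  Complex.exp (a * L) •
    taylorSum (PowerSeries.binomialSeries ℂ a) (Complex.exp (-L) • Φ - 1)

lemma aeval_eq_sum_of_pow_eq_zero {N : A} {n : ℕ} (hN : N ^ n = 0) (p : Polynomial ℂ) :
    Polynomial.aeval N p = ∑ k ∈ Finset.range n, p.coeff k • N ^ k := by
  rw [Polynomial.aeval_eq_sum_range' (n := max n (p.natDegree + 1)) (by simp)]
  symm
  refine Finset.sum_subset (Finset.range_subset_range.2 (le_max_left _ _)) fun k _ hk => ?_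
  rw [pow_eq_zero_of_le (by simpa using hk) hN, smul_zero]

/-- Since `N ^ 13 = 0`, the truncated series is the evaluation at `N` of the truncated polynomial,
and the coefficients of `f * g` below degree 13 depend only on the truncations. -/
lemma taylorSum_mul {N : A} (hN : N ^ 13 = 0) (f g : PowerSeries ℂ) :
    taylorSum (f * g) N = taylorSum f N * taylorSum g N := by
  have key : ∀ h : PowerSeries ℂ,
      taylorSum h N = Polynomial.aeval N (PowerSeries.trunc 13 h) := fun h => by
    rw [aeval_eq_sum_of_pow_eq_zero hN]
    refine Finset.sum_congr rfl fun k hk => ?_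
    rw [PowerSeries.coeff_trunc, if_pos (by simpa using hk)]
  rw [key f, key g, ← map_mul, aeval_eq_sum_of_pow_eq_zero hN]
  refine Finset.sum_congr rfl fun k hk => ?_
  rw [PowerSeries.coeff_mul_eq_coeff_trunc_mul_trunc f g (Finset.mem_range.1 hk),
    ← Polynomial.coe_mul, Polynomial.coeff_coe]

lemma complexPow_add {L : ℂ} {Φ : A} (h : (Complex.exp (-L) • Φ - 1) ^ 13 = 0) (a b : ℂ) :
    complexPow L (a + b) Φ = complexPow L a Φ * complexPow L b Φ := by
  simp only [complexPow]
  rw [PowerSeries.binomialSeries_add, taylorSum_mul h, smul_mul_smul_comm, ← Complex.exp_add,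
    add_mul]

/-- The polynomial in `a` whose value is the binomial coefficient `a` over `k`. -/
def choosePoly (k : ℕ) : Polynomial ℂ :=
  Polynomial.C ((k.factorial : ℂ)⁻¹) * descPochhammer ℂ k

lemma choose_eq_eval (a : ℂ) (k : ℕ) : Ring.choose a k = (choosePoly k).eval a := by
  rw [Ring.choose_eq_smul, choosePoly, Polynomial.eval_mul, Polynomial.eval_C, smul_eq_mul,
    ← Polynomial.aeval_eq_smeval, ← descPochhammer_map (Int.castRingHom ℂ),
    Polynomial.eval_map, Polynomial.aeval_def]
  rfl

lemma coeff_binomialSeries (a : ℂ) (k : ℕ) :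
    PowerSeries.coeff k (PowerSeries.binomialSeries ℂ a) = (choosePoly k).eval a := by
  rw [PowerSeries.binomialSeries_coeff, smul_eq_mul, mul_one, choose_eq_eval]

lemma choosePoly_succ (a : ℂ) (k : ℕ) :
    (k + 1 : ℂ) * (choosePoly (k + 1)).eval a = (a - k) * (choosePoly k).eval a := by
  have : (k + 1 : ℂ) ≠ 0 := by exact_mod_cast k.succ_ne_zero
  have h2 : (k.factorial : ℂ) ≠ 0 := by exact_mod_cast k.factorial_ne_zero
  simp only [choosePoly, descPochhammer_succ_right, Polynomial.eval_mul, Polynomial.eval_C,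
    Polynomial.eval_sub, Polynomial.eval_X, Polynomial.eval_natCast, Nat.factorial_succ,
    Nat.cast_mul, Nat.cast_succ]
  field_simp

lemma choosePoly_zero (a : ℂ) : (choosePoly 0).eval a = 1 := by simp [choosePoly]

lemma choosePoly_one (a : ℂ) : (choosePoly 1).eval a = a := by
  have := choosePoly_succ a 0
  simpa [choosePoly_zero] using this

lemma choosePoly_two (a : ℂ) : (choosePoly 2).eval a = a * (a - 1) / 2 := by
  have := choosePoly_succ a 1
  rw [choosePoly_one] at this
  push_cast at this
  linear_combination this / 2

lemma taylorSum_binomialSeries_natCast {N : A} (hN : N ^ 13 = 0) (n : ℕ) :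
    taylorSum (PowerSeries.binomialSeries ℂ (n : ℂ)) N = (1 + N) ^ n := by
  have h := aeval_eq_sum_of_pow_eq_zero hN ((1 + Polynomial.X) ^ n)
  rw [map_pow, map_add, map_one, Polynomial.aeval_X] at h
  rw [h]
  refine Finset.sum_congr rfl fun k _ => ?_
  rw [PowerSeries.binomialSeries_coeff, Ring.choose_natCast, Polynomial.coeff_one_add_X_pow,
    smul_eq_mul, mul_one]

/-- A vector-valued polynomial function that vanishes on the natural numbers vanishes. -/
lemma eq_zero_of_natCast_eq_zero {ι : Type*} (s : Finset ι) (p : ι → Polynomial ℂ) (v : ι → A)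
    (h : ∀ n : ℕ, ∑ i ∈ s, (p i).eval (n : ℂ) • v i = 0) (a : ℂ) :
    ∑ i ∈ s, (p i).eval a • v i = 0 := by
  rw [← Module.forall_dual_apply_eq_zero_iff ℂ]
  intro φ
  set q : Polynomial ℂ := ∑ i ∈ s, Polynomial.C (φ (v i)) * p i with hq
  have hev : ∀ b, q.eval b = φ (∑ i ∈ s, (p i).eval b • v i) := fun b => by
    simp [hq, Polynomial.eval_finsetSum, mul_comm]
  have hq0 : q = 0 := by
    refine Polynomial.eq_zero_of_infinite_isRoot _
      (Set.Infinite.mono ?_ (Set.infinite_range_of_injective (Nat.cast_injective (R := ℂ))))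
    rintro _ ⟨n, rfl⟩
    rw [Set.mem_ofPred_eq, Polynomial.IsRoot.def, hev, h, map_zero]
  rw [← hev, hq0, Polynomial.eval_zero]

/-- This is `((1 + N) (1 + M)) ^ a = (1 + N) ^ a (1 + M) ^ a`. The difference of the two sides is
polynomial in `a` with values in the algebra, and it vanishes at every natural number. -/
lemma taylorSum_binomialSeries_mul {N M : A} (hN : N ^ 13 = 0) (hM : M ^ 13 = 0)
    (hNM : (N + M + N * M) ^ 13 = 0) (a : ℂ) :
    taylorSum (PowerSeries.binomialSeries ℂ a) (N + M + N * M) =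
      taylorSum (PowerSeries.binomialSeries ℂ a) N *
        taylorSum (PowerSeries.binomialSeries ℂ a) M := by
  have hform : ∀ b : ℂ, taylorSum (PowerSeries.binomialSeries ℂ b) (N + M + N * M) -
      taylorSum (PowerSeries.binomialSeries ℂ b) N *
        taylorSum (PowerSeries.binomialSeries ℂ b) M =
      ∑ i ∈ (Finset.range 13).disjSum (Finset.range 13 ×ˢ Finset.range 13),
        (Sum.elim (fun k => choosePoly k) (fun k => - (choosePoly k.1 * choosePoly k.2)) i).eval b •
        (Sum.elim (fun k => (N + M + N * M) ^ k) (fun k => N ^ k.1 * M ^ k.2) i : A) := fun b => by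
    rw [Finset.sum_disjSum, Finset.sum_product]
    simp only [taylorSum, coeff_binomialSeries, Sum.elim_inl, Sum.elim_inr,
      Finset.sum_mul_sum, Polynomial.eval_neg, Polynomial.eval_mul, neg_smul,
      Finset.sum_neg_distrib, sub_eq_add_neg, smul_mul_smul_comm]
  rw [← sub_eq_zero, hform]
  refine eq_zero_of_natCast_eq_zero _ _ _ (fun n => ?_) a
  rw [← hform, taylorSum_binomialSeries_natCast hN, taylorSum_binomialSeries_natCast hM,
    taylorSum_binomialSeries_natCast hNM, sub_eq_zero, ← mul_pow]
  ring

/-- `Φ` equals `exp L` up to an element of the ideal `I`. -/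
def HasLog (I : Ideal A) (L : ℂ) (Φ : A) : Prop := Complex.exp (-L) • Φ - 1 ∈ I

variable {I : Ideal A}

lemma HasLog.mul {L M : ℂ} {Φ Ψ : A} (h : HasLog I L Φ) (h' : HasLog I M Ψ) :
    HasLog I (L + M) (Φ * Ψ) := by
  have : Complex.exp (-(L + M)) • (Φ * Ψ) - 1 =
      (Complex.exp (-L) • Φ - 1) * (Complex.exp (-M) • Ψ) + (Complex.exp (-M) • Ψ - 1) := by
    rw [neg_add, Complex.exp_add, sub_mul, smul_mul_smul_comm, one_mul]; abel
  rw [HasLog, this]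
  exact I.add_mem (I.mul_mem_right _ h) h'

lemma complexPow_mul (hI : ∀ N ∈ I, N ^ 13 = 0) {L M : ℂ} {Φ Ψ : A}
    (h : HasLog I L Φ) (h' : HasLog I M Ψ) (a : ℂ) :
    complexPow (L + M) a (Φ * Ψ) = complexPow L a Φ * complexPow M a Ψ := by
  have h1 : Complex.exp (-(L + M)) • (Φ * Ψ) - 1 =
      (Complex.exp (-L) • Φ - 1) + (Complex.exp (-M) • Ψ - 1) +
      (Complex.exp (-L) • Φ - 1) * (Complex.exp (-M) • Ψ - 1) := by
    rw [neg_add, Complex.exp_add, ← smul_mul_smul_comm]; ring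
  have h2 := h.mul h'
  rw [HasLog, h1] at h2
  simp only [complexPow]
  rw [h1, taylorSum_binomialSeries_mul (hI _ h) (hI _ h') (hI _ h2), smul_mul_smul_comm,
    ← Complex.exp_add, mul_add]

lemma complexPow_zero (L : ℂ) (Φ : A) : complexPow L 0 Φ = 1 := by
  rw [complexPow, PowerSeries.binomialSeries_zero, zero_mul, Complex.exp_zero, one_smul,
    taylorSum, Finset.sum_eq_single 0] <;> simp +contextual [PowerSeries.coeff_one]

lemma complexPow_neg_mul (hI : ∀ N ∈ I, N ^ 13 = 0) {L : ℂ} {Φ : A} (h : HasLog I L Φ) (a : ℂ) :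
    complexPow L (-a) Φ * complexPow L a Φ = 1 := by
  rw [← complexPow_add (hI _ h), neg_add_cancel, complexPow_zero]

lemma HasLog.isUnit (hI : ∀ N ∈ I, N ^ 13 = 0) {L : ℂ} {Φ : A} (h : HasLog I L Φ) : IsUnit Φ := by
  have h1 : IsUnit (Complex.exp (-L) • Φ) := by
    have := IsNilpotent.isUnit_add_one (r := Complex.exp (-L) • Φ - 1) ⟨13, hI _ h⟩
    rwa [sub_add_cancel] at this
  rw [Algebra.smul_def] at h1
  exact isUnit_of_mul_isUnit_right h1

lemma taylorSum_eq_of_cube_eq_zero {A : Type*} [Ring A] [Algebra ℂ A] {N : A} (hN : N ^ 3 = 0)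
    (f : PowerSeries ℂ) :
    taylorSum f N = algebraMap ℂ A (f.coeff 0) + f.coeff 1 • N + f.coeff 2 • N ^ 2 := by
  rw [taylorSum, ← Finset.sum_subset (Finset.range_subset_range.2 (show 3 ≤ 13 by norm_num))]
  · simp [Finset.sum_range_succ, Algebra.algebraMap_eq_smul_one]
  · intro k _ hk
    rw [pow_eq_zero_of_le (by simpa using hk) hN, smul_zero]

end Series

/-! ## Nilpotent central elements -/

section Nilpotent

variable {A : Type*} [Ring A] {ι : Type*} {δ : ι → A}

lemma mul_list_prod_eq_zero (hsq : ∀ i, δ i * δ i = 0) (hanti : ∀ i j, δ i * δ j = -(δ j * δ i))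
    {i : ι} {l : List ι} (hi : i ∈ l) : δ i * (l.map δ).prod = 0 := by
  induction l with
  | nil => simp at hi
  | cons j t ih =>
    rw [List.map_cons, List.prod_cons, ← mul_assoc]
    rcases List.mem_cons.1 hi with rfl | h
    · rw [hsq, zero_mul]
    · rw [hanti, neg_mul, mul_assoc, ih h, mul_zero, neg_zero]

lemma mul_mul_eq_zero_of_mem_span {Y w N : A} (hY : ∀ b, Y * b = b * Y)
    (h : ∀ i, Y * (δ i * w) = 0) (hN : N ∈ Ideal.span (Set.range δ)) : Y * (N * w) = 0 := by
  induction hN using Submodule.span_induction with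
  | mem x hx => obtain ⟨i, rfl⟩ := hx; exact h i
  | zero => simp
  | add x y _ _ hx hy => rw [add_mul, mul_add, hx, hy, add_zero]
  | smul a x _ hx => rw [smul_eq_mul, mul_assoc, ← mul_assoc, hY, mul_assoc, hx, mul_zero]

/-- A central element of the left ideal generated by `n` anticommuting elements of square zero
has vanishing `(n + 1)`-st power. -/
lemma pow_eq_zero_of_mem_span [Fintype ι] (hsq : ∀ i, δ i * δ i = 0)
    (hanti : ∀ i j, δ i * δ j = -(δ j * δ i)) {N : A} (hc : ∀ b, N * b = b * N)
    (hN : N ∈ Ideal.span (Set.range δ)) : N ^ (Fintype.card ι + 1) = 0 := by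
  classical
  have hpow : ∀ m b, N ^ m * b = b * N ^ m := fun m b => (Commute.pow_left (hc b) m)
  -- Each factor `N` contributes some `δ i`: either it repeats a factor of the product and kills it,
  -- or it lengthens the product. With all indices present, one more factor `N` gives zero.
  have key : ∀ (m : ℕ) (l : List ι), l.Nodup → l.length + m = Fintype.card ι →
      N ^ (m + 1) * (l.map δ).prod = 0 := by
    intro m
    induction m with
    | zero =>
      intro l hl hlen
      have hall : ∀ i, i ∈ l := fun i => by
        have : l.toFinset = Finset.univ := by
          rw [← Finset.card_eq_iff_eq_univ, List.toFinset_card_of_nodup hl]; simpa using hlen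
        rw [← List.mem_toFinset, this]; exact Finset.mem_univ i
      have := mul_mul_eq_zero_of_mem_span (Y := 1) (w := (l.map δ).prod) (by simp)
        (fun i => by rw [mul_list_prod_eq_zero hsq hanti (hall i), mul_zero]) hN
      simpa using this
    | succ m ih =>
      intro l hl hlen
      rw [pow_succ, mul_assoc]
      refine mul_mul_eq_zero_of_mem_span (hpow _) (fun i => ?_) hN
      by_cases hi : i ∈ l
      · rw [mul_list_prod_eq_zero hsq hanti hi, mul_zero]
      · have := ih (i :: l) (List.nodup_cons.2 ⟨hi, hl⟩) (by simp; omega)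
        simpa using this
  simpa using key (Fintype.card ι) [] List.nodup_nil (by simp)

end Nilpotent

/-! ## Central elements of the Grassmann algebra -/

open ExteriorAlgebra (ι)

lemma ι_mul_ι_comm (v w : Gen → ℂ) : ι ℂ v * ι ℂ w = -(ι ℂ w * ι ℂ v) :=
  eq_neg_of_add_eq_zero_left (ExteriorAlgebra.ι_add_mul_swap v w)

lemma ι_mul_ι_mem_center (v w : Gen → ℂ) :
    ι ℂ v * ι ℂ w ∈ Subalgebra.center ℂ Grassmann := by
  rw [Subalgebra.mem_center_iff]
  intro b
  induction b using ExteriorAlgebra.induction with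
  | algebraMap r => exact Algebra.commutes _ _
  | ι u => rw [← mul_assoc, ι_mul_ι_comm u v, neg_mul, mul_assoc, ι_mul_ι_comm u w, mul_neg,
      neg_neg, mul_assoc]
  | mul a b ha hb => rw [mul_assoc, hb, ← mul_assoc, ha, mul_assoc]
  | add a b ha hb => rw [add_mul, mul_add, ha, hb]

/-- The center of the Grassmann algebra, which contains all superfields considered here. -/
def Center : Type := Subalgebra.center ℂ Grassmann

instance : CommRing Center := inferInstanceAs (CommRing (Subalgebra.center ℂ Grassmann))

instance : Algebra ℂ Center := inferInstanceAs (Algebra ℂ (Subalgebra.center ℂ Grassmann))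

/-- The inclusion of the center. -/
def Center.val : Center →ₐ[ℂ] Grassmann := (Subalgebra.center ℂ Grassmann).val

lemma Center.val_injective : Function.Injective Center.val := Subtype.val_injective

lemma Center.comm (r : Center) (b : Grassmann) : r.val * b = b * r.val :=
  (Subalgebra.mem_center_iff.1 r.2 b).symm

/-- The central element `θ_j^d θbar_i^c`. -/
def pair (j : Fin 3) (d : Fin 2) (i : Fin 3) (c : Fin 2) : Center :=
  (⟨θ j d * θbar i c, ι_mul_ι_mem_center _ _⟩ : Subalgebra.center ℂ Grassmann)

lemma val_pair (j : Fin 3) (d : Fin 2) (i : Fin 3) (c : Fin 2) :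
    (pair j d i c).val = θ j d * θbar i c := rfl

/-- The central elements in the left ideal generated by the coordinates `θ_i^a`. -/
def nilIdeal : Ideal Center :=
  Ideal.comap Center.val (Ideal.span (Set.range fun p : Fin 3 × Fin 2 => θ p.1 p.2))

/-- The six `θ` alone generate the ideal. This gives 7 rather than 13, a margin used in
`HasSuperDeriv.complexPow`. -/
lemma pow_seven_eq_zero {N : Center} (hN : N ∈ nilIdeal) : N ^ 7 = 0 := by
  have := pow_eq_zero_of_mem_span (δ := fun p : Fin 3 × Fin 2 => θ p.1 p.2)
    (fun _ => ExteriorAlgebra.ι_sq_zero _) (fun _ _ => ι_mul_ι_comm _ _) N.comm hN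
  exact Center.val_injective (by rw [map_pow, map_zero]; exact this)

lemma pow_thirteen_eq_zero (N : Center) (hN : N ∈ nilIdeal) : N ^ 13 = 0 :=
  pow_eq_zero_of_le (by norm_num) (pow_seven_eq_zero hN)

lemma pair_mem_nilIdeal (j : Fin 3) (d : Fin 2) (i : Fin 3) (c : Fin 2) :
    pair j d i c ∈ nilIdeal := by
  change θ j d * θbar i c ∈ Ideal.span (Set.range fun p : Fin 3 × Fin 2 => θ p.1 p.2)
  rw [θ, θbar, ι_mul_ι_comm, ← neg_mul]
  exact Ideal.mul_mem_left _ _ (Ideal.subset_span ⟨(j, d), rfl⟩)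

/-! ## The intervals as matrices -/

/-- The matrix `∑ μ, (x_i - x_j)^μ σ^μ`. -/
def bodyMatrix (i j : Fin 3) (x : Config) : Matrix (Fin 2) (Fin 2) ℂ :=
  ∑ μ, ((x i μ - x j μ : ℝ) : ℂ) • pauli μ

lemma det_bodyMatrix (i j : Fin 3) (x : Config) : (bodyMatrix i j x).det = bodySq i j x := by
  rw [Matrix.det_fin_two]
  simp [bodyMatrix, bodySq, pauli, minkowski, Fin.sum_univ_four, Matrix.sum_apply]
  linear_combination (((x i 2 : ℂ) - x j 2) ^ 2) * Complex.I_sq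

/-- The matrix `∑ μ, x_{ībar j}^μ σ^μ`. -/
def intervalMatrix (i j : Fin 3) (x : Config) : Matrix (Fin 2) (Fin 2) Center :=
  Matrix.of fun c d => algebraMap ℂ Center (bodyMatrix i j x c d) +
    (2 * Complex.I) • (pair i d i c + pair j d j c - 2 * pair j d i c)

/-- The interval `x_{ībar j}` as a central element. -/
def centralInterval (i j : Fin 3) (μ : Fin 4) (x : Config) : Center :=
  algebraMap ℂ Center ((x i μ - x j μ : ℝ) : ℂ) +
    Complex.I • ∑ a, ∑ b, pauli μ a b • (pair i a i b + pair j a j b - 2 * pair j a i b)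

lemma val_centralInterval (i j : Fin 3) (μ : Fin 4) (x : Config) :
    (centralInterval i j μ x).val = interval i j μ x := by
  simp only [centralInterval, interval, xMinus, xPlus, bilin, map_add, map_sub, map_smul,
    val_pair, AlgHom.commutes, Fin.sum_univ_two, Complex.ofReal_sub,
    smul_add, smul_sub, two_mul, add_smul]
  abel

/-- Completeness of the Pauli matrices, `∑ σ^μ_cd σ^μ_ab = 2 δ_cb δ_da`, summed without the metric.
It is the reason for the transposed indices in `intervalMatrix`. -/
lemma sum_pauli_smul_sum_pauli {S : Type*} [AddCommGroup S] [Module ℂ S] (p : Fin 2 → Fin 2 → S)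
    (c d : Fin 2) :
    ∑ μ, pauli μ c d • ∑ a, ∑ b, pauli μ a b • p a b = (2 : ℂ) • p d c := by
  fin_cases c <;> fin_cases d <;>
    simp [pauli, Fin.sum_univ_four, Fin.sum_univ_two, smul_smul, two_smul, smul_add] <;> abel

lemma det_sum_pauli {S : Type*} [CommRing S] [Algebra ℂ S] (t : Fin 4 → S) :
    (Matrix.of fun c d : Fin 2 => ∑ μ, pauli μ c d • t μ).det =
      ∑ μ, minkowski μ • (t μ * t μ) := by
  have hI : algebraMap ℂ S Complex.I * algebraMap ℂ S Complex.I = -1 := by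
    rw [← map_mul, Complex.I_mul_I, map_neg, map_one]
  rw [Matrix.det_fin_two]
  simp [pauli, minkowski, Fin.sum_univ_four, Algebra.smul_def]
  linear_combination (t 2 * t 2) * hI

lemma intervalMatrix_eq (i j : Fin 3) (x : Config) :
    intervalMatrix i j x =
      Matrix.of fun c d : Fin 2 => ∑ μ, pauli μ c d • centralInterval i j μ x := by
  ext1 c d
  simp only [intervalMatrix, centralInterval, Matrix.of_apply, smul_add, Finset.sum_add_distrib,
    smul_comm _ Complex.I]
  rw [← Finset.smul_sum, sum_pauli_smul_sum_pauli, smul_smul, mul_comm Complex.I]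
  congr 1
  rw [bodyMatrix, Matrix.sum_apply, map_sum]
  refine Finset.sum_congr rfl fun μ _ => ?_
  rw [Matrix.smul_apply, smul_eq_mul, map_mul, Algebra.smul_def, mul_comm]

/-- The square `(x_{ībar j})²` as a central element. -/
def centralSq (i j : Fin 3) (x : Config) : Center := (intervalMatrix i j x).det

lemma val_centralSq (i j : Fin 3) (x : Config) :
    (centralSq i j x).val = intervalSq i j x := by
  rw [centralSq, intervalMatrix_eq, det_sum_pauli, intervalSq, map_sum]
  simp only [map_smul, map_mul, val_centralInterval]

lemma intervalMatrix_sub_mem (i j : Fin 3) (x : Config) (c d : Fin 2) :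
    intervalMatrix i j x c d - algebraMap ℂ Center (bodyMatrix i j x c d) ∈ nilIdeal := by
  rw [intervalMatrix, Matrix.of_apply, add_sub_cancel_left, Algebra.smul_def]
  exact Ideal.mul_mem_left _ _ (sub_mem (add_mem (pair_mem_nilIdeal _ _ _ _) (pair_mem_nilIdeal _ _ _ _))
    (Ideal.mul_mem_left _ _ (pair_mem_nilIdeal _ _ _ _)))

lemma centralSq_sub_mem (i j : Fin 3) (x : Config) :
    centralSq i j x - algebraMap ℂ Center (bodySq i j x) ∈ nilIdeal := by
  rw [← Ideal.Quotient.eq, centralSq, ← det_bodyMatrix, RingHom.map_det, RingHom.map_det,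
    RingHom.map_det]
  congr 1
  ext c d
  exact Ideal.Quotient.eq.2 (intervalMatrix_sub_mem i j x c d)

lemma hasLog_centralSq {i j : Fin 3} {x : Config} {L : ℂ} (h : Complex.exp L = bodySq i j x) :
    HasLog nilIdeal L (centralSq i j x) := by
  have := Ideal.mul_mem_left _ (algebraMap ℂ Center (Complex.exp (-L))) (centralSq_sub_mem i j x)
  rwa [mul_sub, ← map_mul, ← h, ← Complex.exp_add, neg_add_cancel, Complex.exp_zero, map_one,
    ← Algebra.smul_def] at this

/-! ## The cube of the three-point invariant vanishes -/

lemma Center.mul_left_comm (r : Center) (a b : Grassmann) : a * (r.val * b) = r.val * (a * b) := by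
  rw [← mul_assoc, ← r.comm, mul_assoc]

/-- The combinations of the odd coordinates with central coefficients. -/
def oddSpan : AddSubgroup Grassmann :=
  AddSubgroup.closure {y | ∃ (r : Center) (v : Gen → ℂ), y = r.val * ι ℂ v}

lemma val_mul_ι_mem_oddSpan (r : Center) (v : Gen → ℂ) : r.val * ι ℂ v ∈ oddSpan :=
  AddSubgroup.subset_closure ⟨r, v, rfl⟩

lemma oddSpan_anticomm {y z : Grassmann} (hy : y ∈ oddSpan) (hz : z ∈ oddSpan) :
    y * z = -(z * y) := by
  induction hy, hz using AddSubgroup.closure_induction₂ with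
  | mem y z hy hz =>
    obtain ⟨r, v, rfl⟩ := hy
    obtain ⟨s, w, rfl⟩ := hz
    rw [mul_assoc, s.mul_left_comm, mul_assoc, r.mul_left_comm, ι_mul_ι_comm v w, mul_neg, mul_neg,
      ← mul_assoc, r.comm s.val, mul_assoc]
  | zero_left => simp
  | zero_right => simp
  | add_left y y' z _ _ _ h h' => rw [add_mul, mul_add, h, h', neg_add]
  | add_right y z z' _ _ _ h h' => rw [add_mul, mul_add, h, h', neg_add]
  | neg_left y z _ _ h => rw [neg_mul, mul_neg, h]
  | neg_right y z _ _ h => rw [neg_mul, mul_neg, h]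

lemma oddSpan_sq {y : Grassmann} (hy : y ∈ oddSpan) : y * y = 0 := by
  have h := oddSpan_anticomm hy hy
  rwa [eq_neg_iff_add_eq_zero, ← two_smul ℂ, smul_eq_zero, or_iff_right two_ne_zero] at h

/-- The matrix of the products `(θ_j - θ_1)^d (θbar_i - θbar_1)^c`. -/
def pairMatrix (i j : Fin 3) : Matrix (Fin 2) (Fin 2) Center :=
  Matrix.of fun c d => pair j d i c - pair j d 0 c - pair 0 d i c + pair 0 d 0 c

lemma val_pairMatrix (i j : Fin 3) (c d : Fin 2) :
    (pairMatrix i j c d).val = (θ j d - θ 0 d) * (θbar i c - θbar 0 c) := by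
  rw [pairMatrix, Matrix.of_apply]
  simp only [map_add, map_sub, val_pair]
  noncomm_ring

lemma bodyMatrix_sub (i j : Fin 3) (x : Config) :
    bodyMatrix i j x = bodyMatrix i 0 x - bodyMatrix j 0 x := by
  simp only [bodyMatrix, ← Finset.sum_sub_distrib, ← sub_smul, Complex.ofReal_sub,
    sub_sub_sub_cancel_right]

lemma bodyMatrix_self (i : Fin 3) (x : Config) : bodyMatrix i i x = 0 := by
  simp [bodyMatrix]

/-- A superspace translation of point 0 to the origin: all intervals are expressed by those ending
at point 0 and by products of differences of odd coordinates. -/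
lemma intervalMatrix_eq_sub (i j : Fin 3) (x : Config) :
    intervalMatrix i j x = intervalMatrix i 0 x - intervalMatrix j 0 x +
      (-4 * Complex.I) • (pairMatrix i j - pairMatrix j j) := by
  ext1 c d
  simp only [intervalMatrix, pairMatrix, bodyMatrix_sub i j, Matrix.of_apply, Matrix.add_apply,
    Matrix.sub_apply, Matrix.smul_apply, map_sub]
  simp only [Algebra.smul_def, map_mul, map_neg, map_ofNat]
  ring

lemma intervalMatrix_self (i : Fin 3) (x : Config) : intervalMatrix i i x = 0 := by
  ext1 c d
  simp only [intervalMatrix, bodyMatrix_self, Matrix.of_apply, Matrix.zero_apply, map_zero]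
  rw [← two_mul, sub_self, smul_zero, add_zero]

lemma pairMatrix_zero_left (j : Fin 3) : pairMatrix 0 j = 0 := by
  ext1 c d
  simp [pairMatrix]

/-- Both sides equal `det (A - B) * det A * det B * det (1 + P) * det (1 + Q)`; the signs disappear
because the size is even. -/
lemma det_cross_identity {K : Type*} [CommRing K] {A B P Q X01 X02 X12 X21 : Matrix (Fin 2) (Fin 2) K}
    (h01 : X01 = -(A * (1 + P))) (h02 : X02 = -(B * (1 + Q)))
    (h12 : X12 = (A - B) * (1 + Q)) (h21 : X21 = -((A - B) * (1 + P))) :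
    X12.det * B.det * X01.det = A.det * X02.det * X21.det := by
  rw [h01, h02, h12, h21]
  simp only [Matrix.det_neg, Matrix.det_mul, Fintype.card_fin]
  ring

/-- Modulo the components of `δ`, the matrices `A⁻¹ * pairMatrix 1 j` and `B⁻¹ * pairMatrix 2 j`
coincide, and all intervals factor as `det_cross_identity` requires. Two odd generators make the
cube of every element vanish. -/
lemma exists_nilpotent_ideal {x : Config} (h10 : IsUnit (centralSq 1 0 x))
    (h20 : IsUnit (centralSq 2 0 x)) :
    ∃ I : Ideal Center, (∀ N ∈ I, N ^ 3 = 0) ∧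
      centralSq 1 2 x * centralSq 2 0 x * centralSq 0 1 x -
        centralSq 1 0 x * centralSq 0 2 x * centralSq 2 1 x ∈ I := by
  set A := intervalMatrix 1 0 x with hA
  set B := intervalMatrix 2 0 x with hB
  -- This is `A⁻¹ (θbar_1 - θbar_0) - B⁻¹ (θbar_2 - θbar_0)`, the odd three-point combination whose
  -- vanishing makes the two pair matrices proportional to `A` and `B` with the same factor.
  set δ : Fin 2 → Grassmann := fun k =>
    ∑ c, (A⁻¹ k c).val * (θbar 1 c - θbar 0 c) - ∑ c, (B⁻¹ k c).val * (θbar 2 c - θbar 0 c) with hδ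
  have hδmem : ∀ k, δ k ∈ oddSpan := fun k => by
    refine sub_mem (sum_mem fun c _ => ?_) (sum_mem fun c _ => ?_) <;>
    · rw [θbar, θbar, ← map_sub]
      exact val_mul_ι_mem_oddSpan _ _
  set I : Ideal Center := Ideal.comap Center.val (Ideal.span (Set.range δ)) with hI
  refine ⟨I, fun N hN => ?_, ?_⟩
  · have := pow_eq_zero_of_mem_span (δ := δ) (fun k => oddSpan_sq (hδmem k))
      (fun k l => oddSpan_anticomm (hδmem k) (hδmem l)) N.comm hN
    exact Center.val_injective (by rw [map_pow, map_zero]; exact this)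
  · have hAA : A * A⁻¹ = 1 := Matrix.mul_nonsing_inv _ h10
    have hBB : B * B⁻¹ = 1 := Matrix.mul_nonsing_inv _ h20
    set f := Ideal.Quotient.mk I with hf
    have hmem : ∀ j k d, (A⁻¹ * pairMatrix 1 j) k d - (B⁻¹ * pairMatrix 2 j) k d ∈ I := by
      intro j k d
      have : ((A⁻¹ * pairMatrix 1 j) k d - (B⁻¹ * pairMatrix 2 j) k d).val =
          (θ j d - θ 0 d) * δ k := by
        simp only [Matrix.mul_apply, map_sub, map_sum, map_mul, val_pairMatrix, hδ,
          mul_sub (θ j d - θ 0 d), Finset.mul_sum, Center.mul_left_comm]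
      rw [hI, Ideal.mem_comap, this]
      exact Ideal.mul_mem_left _ _ (Ideal.subset_span ⟨k, rfl⟩)
    have hBA : ∀ j, f.mapMatrix (pairMatrix 2 j) =
        f.mapMatrix B * f.mapMatrix (A⁻¹ * pairMatrix 1 j) := fun j => by
      have : f.mapMatrix (A⁻¹ * pairMatrix 1 j) = f.mapMatrix (B⁻¹ * pairMatrix 2 j) := by
        ext k d
        exact Ideal.Quotient.eq.2 (hmem j k d)
      rw [this, ← map_mul, ← mul_assoc, hBB, one_mul]
    have hAW : ∀ j, f.mapMatrix (pairMatrix 1 j) =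
        f.mapMatrix A * f.mapMatrix (A⁻¹ * pairMatrix 1 j) := fun j => by
      rw [← map_mul, ← mul_assoc, hAA, one_mul]
    have hsm : ∀ (z : ℂ) (M : Matrix (Fin 2) (Fin 2) Center),
        f.mapMatrix (z • M) = z • f.mapMatrix M := fun z M => by
      ext k d
      exact map_smul (Ideal.Quotient.mkₐ ℂ I) z (M k d)
    rw [← Ideal.Quotient.eq]
    simp only [centralSq, map_mul, RingHom.map_det]
    refine det_cross_identity (P := (-4 * Complex.I) • f.mapMatrix (A⁻¹ * pairMatrix 1 1))
      (Q := (-4 * Complex.I) • f.mapMatrix (A⁻¹ * pairMatrix 1 2)) ?_ ?_ ?_ ?_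
    · rw [intervalMatrix_eq_sub, intervalMatrix_self, pairMatrix_zero_left, map_add, map_sub, hsm,
        map_sub, hAW, map_zero, mul_add, mul_one, mul_smul_comm, zero_sub, zero_sub, smul_neg]
      abel
    · rw [intervalMatrix_eq_sub, intervalMatrix_self, pairMatrix_zero_left, map_add, map_sub, hsm,
        map_sub, hBA, map_zero, mul_add, mul_one, mul_smul_comm, zero_sub, zero_sub, smul_neg]
      abel
    · rw [intervalMatrix_eq_sub, map_add, map_sub, hsm, map_sub, hBA, hAW, mul_add, mul_one,
        mul_smul_comm, sub_mul, smul_sub]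
    · rw [intervalMatrix_eq_sub, map_add, map_sub, hsm, map_sub, hBA, hAW, mul_add, mul_one,
        mul_smul_comm, sub_mul, smul_sub, smul_sub]
      abel

/-! ## The three-point functions as central elements -/

lemma map_taylorSum {A B : Type*} [Ring A] [Algebra ℂ A] [Ring B] [Algebra ℂ B] (φ : A →ₐ[ℂ] B)
    (f : PowerSeries ℂ) (N : A) : φ (taylorSum f N) = taylorSum f (φ N) := by
  simp only [taylorSum, map_sum, map_smul, map_pow]

lemma map_complexPow {A B : Type*} [Ring A] [Algebra ℂ A] [Ring B] [Algebra ℂ B] (φ : A →ₐ[ℂ] B)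
    (L a : ℂ) (Φ : A) : φ (complexPow L a Φ) = complexPow L a (φ Φ) := by
  simp only [complexPow, map_smul, map_taylorSum, map_sub, map_one]

lemma taylorEval_eq (f : PowerSeries ℂ) (N : Grassmann) : taylorEval f N = taylorSum f N := rfl

lemma gpow_eq (L a : ℂ) (Φ : Grassmann) : gpow L a Φ = complexPow L a Φ := rfl

lemma inverse_val {r s : Center} (h : r * s = 1) : Ring.inverse r.val = s.val :=
  Ring.inverse_unit ⟨r.val, s.val, by rw [← map_mul, h, map_one],
    by rw [← map_mul, mul_comm, h, map_one]⟩

lemma inverse_val_of_isUnit {r : Center} (h : IsUnit r) :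
    Ring.inverse r.val = (Ring.inverse r).val :=
  inverse_val (Ring.mul_inverse_cancel r h)

/-- The power `(x_{ībar j}²) ^ a` as a central element. -/
def centralPow (L : Fin 3 → Fin 3 → ℂ) (i j : Fin 3) (a : ℂ) (x : Config) : Center :=
  complexPow (L i j) a (centralSq i j x)

/-- Symmetric logarithms of the squares `(x_i - x_j)²` at the configuration `x`. -/
structure IsLogAt (x : Config) (L : Fin 3 → Fin 3 → ℂ) : Prop where
  symm : ∀ i j, i ≠ j → L i j = L j i
  exp_eq : ∀ i j, i ≠ j → Complex.exp (L i j) = bodySq i j x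

lemma IsLogBranch.isLogAt {U : Set Config} {ℓ : Fin 3 → Fin 3 → Config → ℂ}
    (h : IsLogBranch U ℓ) {x : Config} (hx : x ∈ U) : IsLogAt x fun i j => ℓ i j x :=
  ⟨fun i j hij => h.symm i j hij x hx, fun i j hij => h.exp_eq i j hij x hx⟩

/-- `J_1` as a central element. -/
def centralJ (x : Config) : Center :=
  centralSq 1 2 x * centralSq 2 0 x * centralSq 0 1 x *
    Ring.inverse (centralSq 1 0 x * centralSq 0 2 x * centralSq 2 1 x)

section

variable {x : Config} {L : Fin 3 → Fin 3 → ℂ} (hL : IsLogAt x L)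
include hL

lemma IsLogAt.hasLog {i j : Fin 3} (hij : i ≠ j) : HasLog nilIdeal (L i j) (centralSq i j x) :=
  hasLog_centralSq (hL.exp_eq i j hij)

lemma IsLogAt.isUnit {i j : Fin 3} (hij : i ≠ j) : IsUnit (centralSq i j x) :=
  (hL.hasLog hij).isUnit pow_thirteen_eq_zero

lemma IsLogAt.isUnit_denominator :
    IsUnit (centralSq 1 0 x * centralSq 0 2 x * centralSq 2 1 x) :=
  ((hL.isUnit (by decide)).mul (hL.isUnit (by decide))).mul (hL.isUnit (by decide))

lemma IsLogAt.centralJ_mul :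
    centralJ x * (centralSq 1 0 x * centralSq 0 2 x * centralSq 2 1 x) =
      centralSq 1 2 x * centralSq 2 0 x * centralSq 0 1 x :=
  Ring.inverse_mul_cancel_right _ _ hL.isUnit_denominator

lemma IsLogAt.val_centralJ : (centralJ x).val = J1 x := by
  have h10 := hL.isUnit (show (1 : Fin 3) ≠ 0 by decide)
  have h02 := hL.isUnit (show (0 : Fin 3) ≠ 2 by decide)
  have h20 := hL.isUnit (show (2 : Fin 3) ≠ 0 by decide)
  have h01 := hL.isUnit (show (0 : Fin 3) ≠ 1 by decide)
  have h21 := hL.isUnit (show (2 : Fin 3) ≠ 1 by decide)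
  have hm : centralSq 2 1 x * Ring.inverse (centralSq 2 0 x * centralSq 0 1 x) *
      (Ring.inverse (centralSq 2 1 x) * (centralSq 2 0 x * centralSq 0 1 x)) = 1 := by
    rw [mul_mul_mul_comm, Ring.mul_inverse_cancel _ h21,
      Ring.inverse_mul_cancel _ (h20.mul h01), one_mul]
  rw [J1, X1PlusSq, X1MinusSq]
  simp only [← val_centralSq, ← map_mul]
  rw [inverse_val_of_isUnit (h10.mul h02), inverse_val_of_isUnit (h20.mul h01)]
  simp only [← map_mul]
  rw [inverse_val hm, ← map_mul, centralJ, Ring.mul_inverse_rev, Ring.mul_inverse_rev (centralSq 1 0 x)]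
  congr 1
  ring

lemma IsLogAt.val_centralJ_sub_one : (centralJ x - 1).val = I3PF x := by
  rw [map_sub, map_one, hL.val_centralJ, I3PF]

lemma IsLogAt.centralJ_sub_one_cube : (centralJ x - 1) ^ 3 = 0 := by
  obtain ⟨I, hI, hmem⟩ := exists_nilpotent_ideal (hL.isUnit (show (1 : Fin 3) ≠ 0 by decide))
    (hL.isUnit (show (2 : Fin 3) ≠ 0 by decide))
  refine hI _ ?_
  have hd := hL.isUnit_denominator
  have : centralJ x - 1 = (centralSq 1 2 x * centralSq 2 0 x * centralSq 0 1 x -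
        centralSq 1 0 x * centralSq 0 2 x * centralSq 2 1 x) *
      Ring.inverse (centralSq 1 0 x * centralSq 0 2 x * centralSq 2 1 x) := by
    rw [sub_mul, Ring.mul_inverse_cancel _ hd, centralJ]
  rw [this]
  exact I.mul_mem_right _ hmem

/-- By symmetry of the branches, numerator and denominator of `J1` have the same sum of logarithms.
Hence the body of `J1` is 1 and the branch with logarithm 0 is consistent with the chosen ones. -/
lemma IsLogAt.hasLog_centralJ : HasLog nilIdeal 0 (centralJ x) := by
  have h1 := ((hL.hasLog (show (1 : Fin 3) ≠ 2 by decide)).mul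
    (hL.hasLog (show (2 : Fin 3) ≠ 0 by decide))).mul (hL.hasLog (show (0 : Fin 3) ≠ 1 by decide))
  have h2 := ((hL.hasLog (show (1 : Fin 3) ≠ 0 by decide)).mul
    (hL.hasLog (show (0 : Fin 3) ≠ 2 by decide))).mul (hL.hasLog (show (2 : Fin 3) ≠ 1 by decide))
  rw [hL.symm 1 0 (by decide), hL.symm 0 2 (by decide), hL.symm 2 1 (by decide),
    show L 0 1 + L 2 0 + L 1 2 = L 1 2 + L 2 0 + L 0 1 by ring] at h2
  have h3 := sub_mem h1 h2
  rw [sub_sub_sub_cancel_right, ← smul_sub] at h3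
  have h4 := Ideal.mul_mem_left _ (algebraMap ℂ Center (Complex.exp (L 1 2 + L 2 0 + L 0 1)) *
    Ring.inverse (centralSq 1 0 x * centralSq 0 2 x * centralSq 2 1 x)) h3
  rw [Algebra.smul_def, mul_mul_mul_comm, ← map_mul, ← Complex.exp_add, add_neg_cancel,
    Complex.exp_zero, map_one, one_mul, mul_sub, Ring.inverse_mul_cancel _ hL.isUnit_denominator,
    mul_comm] at h4
  rw [HasLog, neg_zero, Complex.exp_zero, one_smul]
  exact h4

lemma IsLogAt.centralPow_add {i j : Fin 3} (hij : i ≠ j) (a b : ℂ) :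
    centralPow L i j (a + b) x = centralPow L i j a x * centralPow L i j b x :=
  complexPow_add (pow_thirteen_eq_zero _ (hL.hasLog hij)) a b

lemma IsLogAt.centralPow_mul_neg {i j : Fin 3} (hij : i ≠ j) (a : ℂ) :
    centralPow L i j a x * centralPow L i j (-a) x = 1 := by
  rw [mul_comm]
  exact complexPow_neg_mul pow_thirteen_eq_zero (hL.hasLog hij) a

lemma IsLogAt.complexPow_centralJ (a : ℂ) :
    complexPow 0 a (centralJ x) =
      centralPow L 1 2 a x * centralPow L 2 0 a x * centralPow L 0 1 a x *
      (centralPow L 1 0 (-a) x * centralPow L 0 2 (-a) x * centralPow L 2 1 (-a) x) := by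
  have h12 := hL.hasLog (show (1 : Fin 3) ≠ 2 by decide)
  have h20 := hL.hasLog (show (2 : Fin 3) ≠ 0 by decide)
  have h01 := hL.hasLog (show (0 : Fin 3) ≠ 1 by decide)
  have h10 := hL.hasLog (show (1 : Fin 3) ≠ 0 by decide)
  have h02 := hL.hasLog (show (0 : Fin 3) ≠ 2 by decide)
  have h21 := hL.hasLog (show (2 : Fin 3) ≠ 1 by decide)
  have h := complexPow_mul pow_thirteen_eq_zero hL.hasLog_centralJ ((h10.mul h02).mul h21) a
  rw [hL.centralJ_mul, zero_add, show L 1 0 + L 0 2 + L 2 1 = L 1 2 + L 2 0 + L 0 1 by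
    rw [hL.symm 1 0 (by decide), hL.symm 0 2 (by decide), hL.symm 2 1 (by decide)]; ring,
    complexPow_mul pow_thirteen_eq_zero (h12.mul h20) h01,
    complexPow_mul pow_thirteen_eq_zero h12 h20,
    show L 1 2 + L 2 0 + L 0 1 = L 1 0 + L 0 2 + L 2 1 by
    rw [hL.symm 1 0 (by decide), hL.symm 0 2 (by decide), hL.symm 2 1 (by decide)]; ring,
    complexPow_mul pow_thirteen_eq_zero (h10.mul h02) h21,
    complexPow_mul pow_thirteen_eq_zero h10 h02] at h
  change centralPow L 1 2 a x * centralPow L 2 0 a x * centralPow L 0 1 a x =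
    complexPow 0 a (centralJ x) *
      (centralPow L 1 0 a x * centralPow L 0 2 a x * centralPow L 2 1 a x) at h
  have e10 := hL.centralPow_mul_neg (show (1 : Fin 3) ≠ 0 by decide) a
  have e02 := hL.centralPow_mul_neg (show (0 : Fin 3) ≠ 2 by decide) a
  have e21 := hL.centralPow_mul_neg (show (2 : Fin 3) ≠ 1 by decide) a
  rw [h, mul_assoc, show centralPow L 1 0 a x * centralPow L 0 2 a x * centralPow L 2 1 a x *
      (centralPow L 1 0 (-a) x * centralPow L 0 2 (-a) x * centralPow L 2 1 (-a) x) =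
      (centralPow L 1 0 a x * centralPow L 1 0 (-a) x) *
      (centralPow L 0 2 a x * centralPow L 0 2 (-a) x) *
      (centralPow L 2 1 a x * centralPow L 2 1 (-a) x) by ring, e10, e02, e21, mul_one, mul_one,
    mul_one]

end

section

variable {ℓ : Fin 3 → Fin 3 → Config → ℂ} {x : Config}

lemma intervalPow_eq (i j : Fin 3) (a : ℂ) :
    intervalPow ℓ i j a x = (centralPow (fun i j => ℓ i j x) i j a x).val := by
  rw [intervalPow, gpow_eq, centralPow, map_complexPow, val_centralSq]

variable (hL : IsLogAt x fun i j => ℓ i j x)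
include hL

lemma generalThreePoint_eq (η κ : Fin 3 → ℝ) (f : PowerSeries ℂ) :
    generalThreePoint ℓ η κ f x = (taylorSum f (centralJ x - 1) *
      (centralPow (fun i j => ℓ i j x) 0 1 (-Δ η κ 0 1) x *
       centralPow (fun i j => ℓ i j x) 1 0 (-Δ η κ 1 0) x *
       centralPow (fun i j => ℓ i j x) 0 2 (-Δ η κ 0 2) x *
       centralPow (fun i j => ℓ i j x) 2 0 (-Δ η κ 2 0) x *
       centralPow (fun i j => ℓ i j x) 1 2 (-Δ η κ 1 2) x *
       centralPow (fun i j => ℓ i j x) 2 1 (-Δ η κ 2 1) x)).val := by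
  rw [generalThreePoint, taylorEval_eq, ← hL.val_centralJ_sub_one, ← map_taylorSum, map_mul]
  congr 1
  simp only [intervalPow_eq, ← map_mul]
  apply inverse_val
  have h : ∀ {i j : Fin 3}, i ≠ j → ∀ a, _ := fun {i j} hij a => hL.centralPow_mul_neg hij a
  iterate 4 rw [mul_mul_mul_comm, h (by decide), mul_one]
  rw [mul_mul_mul_comm, h (by decide), h (by decide), mul_one]

lemma chiralThreePoint_eq (η : Fin 3 → ℝ) :
    chiralThreePoint ℓ η x = (centralPow (fun i j => ℓ i j x) 0 1 (-η 1) x *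
      centralPow (fun i j => ℓ i j x) 0 2 (-η 2) x).val := by
  rw [chiralThreePoint, intervalPow_eq, intervalPow_eq, ← map_mul]
  apply inverse_val
  rw [mul_mul_mul_comm, hL.centralPow_mul_neg (by decide), hL.centralPow_mul_neg (by decide),
    one_mul]

/-- A power of `J_1` combines with the prefactor to a chiral three-point function. -/
lemma complexPow_centralJ_mul_prefactor {η κ : Fin 3 → ℝ}
    (h20 : Δ η κ 2 0 = -Δ η κ 1 0) (h12 : Δ η κ 1 2 = -Δ η κ 1 0) (h21 : Δ η κ 2 1 = Δ η κ 1 0)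
    (h01 : Δ η κ 0 1 + Δ η κ 1 0 = η 1) (h02 : Δ η κ 0 2 - Δ η κ 1 0 = η 2) :
    (complexPow 0 (-Δ η κ 1 0 : ℂ) (centralJ x) *
      (centralPow (fun i j => ℓ i j x) 0 1 (-Δ η κ 0 1) x *
       centralPow (fun i j => ℓ i j x) 1 0 (-Δ η κ 1 0) x *
       centralPow (fun i j => ℓ i j x) 0 2 (-Δ η κ 0 2) x *
       centralPow (fun i j => ℓ i j x) 2 0 (-Δ η κ 2 0) x *
       centralPow (fun i j => ℓ i j x) 1 2 (-Δ η κ 1 2) x *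
       centralPow (fun i j => ℓ i j x) 2 1 (-Δ η κ 2 1) x)).val = chiralThreePoint ℓ η x := by
  rw [chiralThreePoint_eq hL, hL.complexPow_centralJ, ← h01, ← h02, h20, h12, h21]
  push_cast
  set d : ℂ := (Δ η κ 1 0 : ℂ)
  -- The summands `-d` and `d` are the exponents that `J1 ^ (-d)` supplies for the intervals `(0,
  -- 1)` and `(0, 2)`. For the other four intervals the powers from `J1` and from the prefactor are
  -- inverse to each other.
  rw [show -((Δ η κ 0 1 : ℂ) + d) = -d + -(Δ η κ 0 1 : ℂ) by ring,
    show -((Δ η κ 0 2 : ℂ) - d) = - -d + -(Δ η κ 0 2 : ℂ) by ring,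
    hL.centralPow_add (by decide), hL.centralPow_add (by decide)]
  have e10 := hL.centralPow_mul_neg (show (1 : Fin 3) ≠ 0 by decide) (-d)
  have e20 := hL.centralPow_mul_neg (show (2 : Fin 3) ≠ 0 by decide) (-d)
  have e12 := hL.centralPow_mul_neg (show (1 : Fin 3) ≠ 2 by decide) (-d)
  have e21 := hL.centralPow_mul_neg (show (2 : Fin 3) ≠ 1 by decide) (-d)
  set L : Fin 3 → Fin 3 → ℂ := fun i j => ℓ i j x
  congr 1
  calc _ = (centralPow L 0 1 (-d) x * centralPow L 0 1 (-(Δ η κ 0 1 : ℂ)) x *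
        (centralPow L 0 2 (- -d) x * centralPow L 0 2 (-(Δ η κ 0 2 : ℂ)) x)) *
        ((centralPow L 1 0 (-d) x * centralPow L 1 0 (- -d) x) *
        (centralPow L 2 0 (-d) x * centralPow L 2 0 (- -d) x) *
        (centralPow L 1 2 (-d) x * centralPow L 1 2 (- -d) x) *
        (centralPow L 2 1 (-d) x * centralPow L 2 1 (- -d) x)) := by ring
    _ = _ := by rw [e10, e20, e12, e21]; ring

end

/-! ## Odd derivatives -/

/-- Naturality of contraction: the functional is pulled back along `p`. This is the chain rule for a
linear substitution of the odd coordinates. -/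
lemma contractLeft_map (p : (Gen → ℂ) →ₗ[ℂ] (Gen → ℂ)) (d : Module.Dual ℂ (Gen → ℂ))
    (y : Grassmann) :
    CliffordAlgebra.contractLeft d (ExteriorAlgebra.map p y) =
      ExteriorAlgebra.map p (CliffordAlgebra.contractLeft (d ∘ₗ p) y) := by
  induction y using CliffordAlgebra.left_induction with
  | algebraMap r =>
    rw [AlgHom.commutes, CliffordAlgebra.contractLeft_algebraMap,
      CliffordAlgebra.contractLeft_algebraMap, map_zero]
  | add a b ha hb => simp only [map_add, ha, hb]
  | ι_mul a v ha =>
    rw [CliffordAlgebra.contractLeft_ι_mul, map_mul]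
    erw [ExteriorAlgebra.map_apply_ι, CliffordAlgebra.contractLeft_ι_mul]
    rw [ha, map_sub, map_mul, map_smul]
    erw [ExteriorAlgebra.map_apply_ι]
    rfl

lemma oddDeriv_ι_mul (g : Gen) (v : Gen → ℂ) (y : Grassmann) :
    oddDeriv g (ι ℂ v * y) = v g • y - ι ℂ v * oddDeriv g y :=
  CliffordAlgebra.contractLeft_ι_mul _ _ _

lemma oddDeriv_ι (g : Gen) (v : Gen → ℂ) :
    oddDeriv g (ι ℂ v) = algebraMap ℂ Grassmann (v g) :=
  CliffordAlgebra.contractLeft_ι _ _ _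

lemma oddDeriv_algebraMap (g : Gen) (z : ℂ) : oddDeriv g (algebraMap ℂ Grassmann z) = 0 :=
  CliffordAlgebra.contractLeft_algebraMap _ _ _

lemma oddDeriv_θ_mul (g : Gen) (i : Fin 3) (a : Fin 2) (y : Grassmann) :
    oddDeriv g (θ i a * y) = (if g = Sum.inl (i, a) then (1 : ℂ) else 0) • y - θ i a * oddDeriv g y := by
  rw [θ, oddDeriv_ι_mul, Pi.single_apply]

lemma oddDeriv_θbar_mul (g : Gen) (i : Fin 3) (a : Fin 2) (y : Grassmann) :
    oddDeriv g (θbar i a * y) =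
      (if g = Sum.inr (i, a) then (1 : ℂ) else 0) • y - θbar i a * oddDeriv g y := by
  rw [θbar, oddDeriv_ι_mul, Pi.single_apply]

lemma oddDeriv_θ (g : Gen) (i : Fin 3) (a : Fin 2) :
    oddDeriv g (θ i a) = if g = Sum.inl (i, a) then 1 else 0 := by
  rw [θ, oddDeriv_ι, Pi.single_apply]; split_ifs <;> simp

lemma oddDeriv_θbar (g : Gen) (i : Fin 3) (a : Fin 2) :
    oddDeriv g (θbar i a) = if g = Sum.inr (i, a) then 1 else 0 := by
  rw [θbar, oddDeriv_ι, Pi.single_apply]; split_ifs <;> simp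

/-! ## Linear substitutions of the odd coordinates -/

/-- The algebra endomorphism that replaces the odd coordinate `g` by the linear form `w g`. -/
def subst (w : Gen → Gen → ℂ) : Grassmann →ₐ[ℂ] Grassmann :=
  ExteriorAlgebra.map ((Pi.basisFun ℂ Gen).constr ℂ w)

lemma subst_θ (w : Gen → Gen → ℂ) (i : Fin 3) (a : Fin 2) :
    subst w (θ i a) = ι ℂ (w (Sum.inl (i, a))) := by
  rw [subst, θ, ExteriorAlgebra.map_apply_ι, ← Pi.basisFun_apply, Module.Basis.constr_basis]

lemma subst_θbar (w : Gen → Gen → ℂ) (i : Fin 3) (a : Fin 2) :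
    subst w (θbar i a) = ι ℂ (w (Sum.inr (i, a))) := by
  rw [subst, θbar, ExteriorAlgebra.map_apply_ι, ← Pi.basisFun_apply, Module.Basis.constr_basis]

/-- The hypothesis says that `g` occurs only in its own image, with coefficient 1, so the chain rule
has a single term. -/
lemma oddDeriv_subst {w : Gen → Gen → ℂ} {g : Gen} (hw : ∀ g', w g' g = (Pi.single g' 1 : Gen → ℂ) g)
    (y : Grassmann) : oddDeriv g (subst w y) = subst w (oddDeriv g y) := by
  rw [oddDeriv, subst, contractLeft_map]
  congr 3
  refine (Pi.basisFun ℂ Gen).ext fun g' => ?_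
  rw [LinearMap.comp_apply, Module.Basis.constr_basis, Pi.basisFun_apply]
  exact hw g'

/-- The value of `(x_{ībar j})²` with `θ_j^d θbar_i^c` replaced by `q j d i c`. -/
def substSq (q : Fin 3 → Fin 2 → Fin 3 → Fin 2 → Center) (i j : Fin 3) (x : Config) : Center :=
  (Matrix.of fun c d => algebraMap ℂ Center (bodyMatrix i j x c d) +
    (2 * Complex.I) • (q i d i c + q j d j c - 2 * q j d i c)).det

lemma subst_centralSq {w : Gen → Gen → ℂ} {q : Fin 3 → Fin 2 → Fin 3 → Fin 2 → Center}
    (hq : ∀ j d i c, ι ℂ (w (Sum.inl (j, d))) * ι ℂ (w (Sum.inr (i, c))) = (q j d i c).val)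
    (i j : Fin 3) (x : Config) : subst w (centralSq i j x).val = (substSq q i j x).val := by
  have hp : ∀ j d i c, subst w (pair j d i c).val = (q j d i c).val := fun j d i c => by
    rw [val_pair, map_mul, subst_θ, subst_θbar, hq]
  simp only [centralSq, substSq, Matrix.det_fin_two, intervalMatrix, Matrix.of_apply, map_sub,
    map_add, map_mul, map_smul, hp, AlgHom.commutes, map_ofNat]

lemma complexPow_of_sq_eq_zero {A : Type*} [CommRing A] [Algebra ℂ A] {ε : A} (hε : ε * ε = 0)
    (L a : ℂ) :
    complexPow L a (algebraMap ℂ A (Complex.exp L) * (1 + ε)) =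
      algebraMap ℂ A (Complex.exp (a * L)) * (1 + a • ε) := by
  rw [complexPow, Algebra.smul_def (Complex.exp (-L)), ← mul_assoc, ← map_mul, ← Complex.exp_add,
    neg_add_cancel, Complex.exp_zero, map_one, one_mul, add_sub_cancel_left,
    taylorSum_eq_of_cube_eq_zero (by rw [pow_succ, pow_two, hε, zero_mul]), pow_two, hε, smul_zero,
    add_zero, coeff_binomialSeries, coeff_binomialSeries, choosePoly_zero, choosePoly_one,
    map_one, Algebra.smul_def (Complex.exp (a * L))]

section

variable {ℓ : Fin 3 → Fin 3 → Config → ℂ} {x : Config} (hL : IsLogAt x fun i j => ℓ i j x)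
include hL

lemma subst_centralJ {w : Gen → Gen → ℂ} {s : Fin 3 → Fin 3 → Center}
    (hs : ∀ i j, i ≠ j → subst w (centralSq i j x).val = (s i j).val) {J : Center}
    (hJ : J * (s 1 0 * s 0 2 * s 2 1) = s 1 2 * s 2 0 * s 0 1) :
    subst w (centralJ x).val = J.val := by
  have h1 := congrArg (fun r : Center => subst w r.val) hL.centralJ_mul
  have h2 := congrArg Center.val hJ
  have hu : IsUnit (subst w (centralSq 1 0 x * centralSq 0 2 x * centralSq 2 1 x).val) :=
    (hL.isUnit_denominator.map Center.val).map (subst w)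
  refine hu.mul_right_cancel ?_
  simp only [map_mul, hs 1 0 (by decide), hs 0 2 (by decide), hs 2 1 (by decide),
    hs 1 2 (by decide), hs 2 0 (by decide), hs 0 1 (by decide)] at h1 h2 ⊢
  rw [h1, h2]

/-- A general three-point function after a substitution of the odd coordinates in which all
squares differ from the body by factors `1 + ε i j` with `ε i j ^ 2 = 0`. -/
lemma subst_generalThreePoint {w : Gen → Gen → ℂ} {ε : Fin 3 → Fin 3 → Center}
    (hε : ∀ i j, ε i j * ε i j = 0)
    (hs : ∀ i j, i ≠ j → subst w (centralSq i j x).val =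
      (algebraMap ℂ Center (bodySq i j x) * (1 + ε i j)).val) {J : Center}
    (hJ : J * ((1 + ε 1 0) * (1 + ε 0 2) * (1 + ε 2 1)) =
      (1 + ε 1 2) * (1 + ε 2 0) * (1 + ε 0 1)) (η κ : Fin 3 → ℝ) (f : PowerSeries ℂ) :
    ∃ K : ℂ, K ≠ 0 ∧ subst w (generalThreePoint ℓ η κ f x) = K • (taylorSum f (J - 1) *
      ((1 + (-Δ η κ 0 1 : ℂ) • ε 0 1) * (1 + (-Δ η κ 1 0 : ℂ) • ε 1 0) *
       (1 + (-Δ η κ 0 2 : ℂ) • ε 0 2) * (1 + (-Δ η κ 2 0 : ℂ) • ε 2 0) *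
       (1 + (-Δ η κ 1 2 : ℂ) • ε 1 2) * (1 + (-Δ η κ 2 1 : ℂ) • ε 2 1))).val := by
  have hpow : ∀ i j, i ≠ j → ∀ a : ℂ,
      subst w (centralPow (fun i j => ℓ i j x) i j a x).val =
        (algebraMap ℂ Center (Complex.exp (a * ℓ i j x)) * (1 + a • ε i j)).val := by
    intro i j hij a
    rw [centralPow, map_complexPow, map_complexPow, hs i j hij, ← hL.exp_eq i j hij,
      ← map_complexPow, complexPow_of_sq_eq_zero (hε i j)]
  have hsymm : ∀ i j, i ≠ j → bodySq i j x = bodySq j i x := fun i j hij => by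
    rw [← hL.exp_eq i j hij, ← hL.exp_eq j i hij.symm, hL.symm i j hij]
  -- The bodies multiply to the same number in numerator and denominator, so only the factors `1 +
  -- ε` survive in `J`.
  have hJ' := subst_centralJ hL (J := J) hs (by
    rw [hsymm 1 0 (by decide), hsymm 0 2 (by decide), hsymm 2 1 (by decide)]
    linear_combination (algebraMap ℂ Center (bodySq 0 1 x) * algebraMap ℂ Center (bodySq 2 0 x) *
      algebraMap ℂ Center (bodySq 1 2 x)) * hJ)
  refine ⟨Complex.exp (-Δ η κ 0 1 * ℓ 0 1 x) * Complex.exp (-Δ η κ 1 0 * ℓ 1 0 x) *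
    Complex.exp (-Δ η κ 0 2 * ℓ 0 2 x) * Complex.exp (-Δ η κ 2 0 * ℓ 2 0 x) *
    Complex.exp (-Δ η κ 1 2 * ℓ 1 2 x) * Complex.exp (-Δ η κ 2 1 * ℓ 2 1 x),
    by simp [Complex.exp_ne_zero], ?_⟩
  rw [generalThreePoint_eq hL]
  simp only [map_mul, hpow 0 1 (by decide), hpow 1 0 (by decide), hpow 0 2 (by decide),
    hpow 2 0 (by decide), hpow 1 2 (by decide), hpow 2 1 (by decide)]
  rw [map_taylorSum, map_taylorSum, map_sub, map_sub, map_one, map_one, hJ',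
    ← map_one Center.val, ← map_sub, ← map_taylorSum]
  simp only [← map_mul, ← map_smul]
  congr 1
  simp only [Algebra.smul_def, map_mul]
  ring

end

/-! ## Consequences of the chirality constraints for the Taylor coefficients -/

lemma pair_mul_pair_of_same_bar (j j' i : Fin 3) (d d' c : Fin 2) :
    pair j d i c * pair j' d' i c = 0 := by
  apply Center.val_injective
  rw [map_mul, map_zero, val_pair j', ← Center.mul_left_comm, val_pair, mul_assoc (θ j d), θbar,
    ExteriorAlgebra.ι_sq_zero, mul_zero, mul_zero]

/-- Every spacetime derivative in `D_i` carries a factor `θbar_i`, which the substitution kills. No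
derivative in `x` has to be computed. -/
lemma subst_covD {w : Gen → Gen → ℂ} {i : Fin 3} {a : Fin 2} {G : Superfield} {x : Config}
    (hw : ∀ g', w g' (Sum.inl (i, a)) = (Pi.single g' 1 : Gen → ℂ) (Sum.inl (i, a)))
    (h0 : ∀ b, w (Sum.inr (i, b)) = 0) (h : covD i a G x = 0) :
    oddDeriv (Sum.inl (i, a)) (subst w (G x)) = 0 := by
  have := congrArg (subst w) h
  simpa only [covD, map_sub, map_smul, map_sum, map_mul, subst_θbar, h0, map_zero, zero_mul,
    smul_zero, Finset.sum_const_zero, sub_zero, ← oddDeriv_subst hw] using this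

lemma subst_covDbar {w : Gen → Gen → ℂ} {i : Fin 3} {b : Fin 2} {G : Superfield} {x : Config}
    (hw : ∀ g', w g' (Sum.inr (i, b)) = (Pi.single g' 1 : Gen → ℂ) (Sum.inr (i, b)))
    (h0 : ∀ a, w (Sum.inl (i, a)) = 0) (h : covDbar i b G x = 0) :
    oddDeriv (Sum.inr (i, b)) (subst w (G x)) = 0 := by
  have := congrArg (subst w) h
  simpa only [covDbar, map_add, map_neg, map_smul, map_sum, map_mul, subst_θ, h0, map_zero,
    zero_mul, smul_zero, Finset.sum_const_zero, add_zero, ← oddDeriv_subst hw, neg_eq_zero]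
    using this

/-- The substitution that keeps `θ_1`, makes `θbar_2` and `θbar_3` proportional to one odd
coordinate each and annihilates the other coordinates. -/
def antichiralChart (x : Config) : Gen → Gen → ℂ :=
  Sum.elim (fun p => if p.1 = 0 then Pi.single (Sum.inl p) 1 else 0)
    (fun p => if p.1 = 2 then bodyMatrix 2 0 x p.2 0 • Pi.single (Sum.inr (2, 0)) 1 else
      if p.1 = 1 then bodyMatrix 1 0 x p.2 1 • Pi.single (Sum.inr (1, 0)) 1 else 0)

/-- The images of the products `θ_j^d θbar_i^c` under `antichiralChart`. -/
def antichiralPair (x : Config) (j : Fin 3) (d : Fin 2) (i : Fin 3) (c : Fin 2) : Center :=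
  if j = 0 then
    if i = 2 then bodyMatrix 2 0 x c 0 • pair 0 d 2 0 else
      if i = 1 then bodyMatrix 1 0 x c 1 • pair 0 d 1 0 else 0
  else 0

lemma antichiralChart_pair (x : Config) (j : Fin 3) (d : Fin 2) (i : Fin 3) (c : Fin 2) :
    ι ℂ (antichiralChart x (Sum.inl (j, d))) * ι ℂ (antichiralChart x (Sum.inr (i, c))) =
      (antichiralPair x j d i c).val := by
  simp only [antichiralChart, antichiralPair, Sum.elim_inl, Sum.elim_inr]
  split_ifs with h1 h2 h3 <;>
    simp only [map_zero, zero_mul, mul_zero, smul_zero, map_smul, mul_smul_comm, val_pair, θ, θbar]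
  · rw [h1]
  · rw [h1]

/-- The nilpotent parts of the squares under `antichiralChart`. -/
def antichiralNil (i j : Fin 3) : Center :=
  if (i, j) = (2, 0) then (-4 * Complex.I) • pair 0 0 2 0 else
    if (i, j) = (1, 0) then (-4 * Complex.I) • pair 0 1 1 0 else 0

/-- For `(2, 0)` and `(1, 0)` the body matrix `M` becomes `M * (1 + E)`, where `E` has a single
nonzero row: row 0 for `(2, 0)`, row 1 for `(1, 0)`. This is why the chart uses columns of `M`. The
two diagonal entries of `E` involve different components of `θ_0`, so their product is nonzero and
makes `f₂` visible. -/
lemma antichiral_substSq (x : Config) (i j : Fin 3) (hij : i ≠ j) :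
    substSq (antichiralPair x) i j x =
      algebraMap ℂ Center (bodySq i j x) * (1 + antichiralNil i j) := by
  rw [substSq, Matrix.det_fin_two, ← det_bodyMatrix, Matrix.det_fin_two]
  fin_cases i <;> fin_cases j <;> first | exact absurd rfl hij | skip
  all_goals simp [antichiralPair, antichiralNil, Algebra.smul_def]
  all_goals simp only [map_ofNat]; ring

lemma coeff_eq_zero_of_oddDeriv_eq_zero {z₀ z₁ z₂ z₃ : ℂ} {y : Center}
    (hy : y = algebraMap ℂ Center z₀ + z₁ • pair 0 0 2 0 + z₂ • pair 0 1 1 0 +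
      z₃ • (pair 0 0 2 0 * pair 0 1 1 0))
    (h : ∀ s, oddDeriv (Sum.inl (0, s)) y.val = 0) : z₁ = 0 ∧ z₂ = 0 ∧ z₃ = 0 := by
  have hv : y.val = algebraMap ℂ Grassmann z₀ + z₁ • (θ 0 0 * θbar 2 0) + z₂ • (θ 0 1 * θbar 1 0) +
      z₃ • (θ 0 0 * (θbar 2 0 * (θ 0 1 * θbar 1 0))) := by
    rw [hy]
    simp only [map_add, map_smul, map_mul, val_pair, AlgHom.commutes, mul_assoc]
  have h0 := h 0
  have h1 := h 1
  rw [hv] at h0 h1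
  simp [oddDeriv_algebraMap, oddDeriv_θ_mul, oddDeriv_θbar] at h0
  simp [oddDeriv_algebraMap, oddDeriv_θ_mul, oddDeriv_θbar_mul, oddDeriv_θbar] at h1
  have h01 := congrArg (oddDeriv (Sum.inr (2, 0))) h0
  simp [oddDeriv_θbar, oddDeriv_θ_mul, oddDeriv_θbar_mul] at h01
  have h012 := congrArg (oddDeriv (Sum.inl (0, 1))) h01
  simp [oddDeriv_θ_mul] at h012
  have hz3 : z₃ = 0 := by
    have := congrArg (oddDeriv (Sum.inr (1, 0))) h012
    rw [← map_one (algebraMap ℂ Grassmann), oddDeriv_algebraMap] at this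
    simpa [oddDeriv_θbar] using this
  rw [hz3, zero_smul, add_zero] at h1 h01
  have h1' := congrArg (oddDeriv (Sum.inr (1, 0))) h1
  simp [oddDeriv_θbar] at h1'
  exact ⟨by simpa using h01, h1', hz3⟩

lemma antichiral_coeffs {ℓ : Fin 3 → Fin 3 → Config → ℂ} {x : Config}
    (hL : IsLogAt x fun i j => ℓ i j x) {η κ : Fin 3 → ℝ} {f : PowerSeries ℂ}
    (h : ∀ s, covD 0 s (generalThreePoint ℓ η κ f) x = 0) :
    f.coeff 1 = Δ η κ 2 0 * f.coeff 0 ∧ f.coeff 1 = -Δ η κ 1 0 * f.coeff 0 ∧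
      2 * f.coeff 2 = (Δ η κ 2 0 - 1) * f.coeff 1 := by
  set p₁ : Center := pair 0 0 2 0 with hp₁
  set p₂ : Center := pair 0 1 1 0 with hp₂
  have h₁ : p₁ * p₁ = 0 := pair_mul_pair_of_same_bar _ _ _ _ _ _
  have h₂ : p₂ * p₂ = 0 := pair_mul_pair_of_same_bar _ _ _ _ _ _
  set I : Center := algebraMap ℂ Center Complex.I with hI
  have hII : I * I = -1 := by rw [← map_mul, Complex.I_mul_I, map_neg, map_one]
  have e20 : antichiralNil 2 0 = -4 * I * p₁ := by
    simp [antichiralNil, Algebra.smul_def, hI, hp₁, map_ofNat (algebraMap ℂ Center)]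
  have e10 : antichiralNil 1 0 = -4 * I * p₂ := by
    simp [antichiralNil, Algebra.smul_def, hI, hp₂, map_ofNat (algebraMap ℂ Center)]
  have e01 : antichiralNil 0 1 = 0 := by simp [antichiralNil]
  have e02 : antichiralNil 0 2 = 0 := by simp [antichiralNil]
  have e12 : antichiralNil 1 2 = 0 := by simp [antichiralNil]
  have e21 : antichiralNil 2 1 = 0 := by simp [antichiralNil]
  -- The factor `1 + 4 * I * p₂` is the inverse of `1 + ε 1 0`, because `p₂ ^ 2 = 0`.
  obtain ⟨K, hK, hG⟩ := subst_generalThreePoint hL (w := antichiralChart x) (ε := antichiralNil)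
    (J := (1 - 4 * I * p₁) * (1 + 4 * I * p₂)) (fun i j => by
      rw [antichiralNil]
      split_ifs <;> simp only [smul_mul_smul_comm, pair_mul_pair_of_same_bar, smul_zero, mul_zero])
    (fun i j hij => by
      rw [subst_centralSq (antichiralChart_pair x), antichiral_substSq x i j hij])
    (by
      rw [e20, e10, e01, e02, e12, e21]
      linear_combination (-16 * (1 - 4 * I * p₁) * I * I) * h₂) η κ f
  have hN : (1 - 4 * I * p₁) * (1 + 4 * I * p₂) - 1 = 4 * I * (p₂ - p₁) + 16 * (p₁ * p₂) := by
    linear_combination (-16 * p₁ * p₂) * hII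
  have hN2 : (4 * I * (p₂ - p₁) + 16 * (p₁ * p₂)) ^ 2 = 32 * (p₁ * p₂) := by
    linear_combination (-32 * p₁ * p₂) * hII +
      (16 * I ^ 2 - 128 * I * p₂ + 256 * p₂ ^ 2) * h₁ + (16 * I ^ 2 + 128 * I * p₁) * h₂
  have hN3 : (4 * I * (p₂ - p₁) + 16 * (p₁ * p₂)) ^ 3 = 0 := by
    rw [pow_succ, hN2]
    linear_combination (128 * I * p₁ + 512 * p₁ ^ 2) * h₂ - (128 * I * p₂) * h₁
  rw [hN, taylorSum_eq_of_cube_eq_zero hN3, hN2, e20, e10, e01, e02, e12, e21] at hG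
  have hd : ∀ s, oddDeriv (Sum.inl (0, s)) (subst (antichiralChart x)
      (generalThreePoint ℓ η κ f x)) = 0 := fun s => by
    refine subst_covD (fun g' => ?_) (fun b => ?_) (h s)
    · rcases g' with ⟨i, a⟩ | ⟨i, a⟩
      · fin_cases i <;> simp [antichiralChart, Pi.single_apply]
      · fin_cases i <;> simp [antichiralChart]
    · simp [antichiralChart]
  simp only [hG, map_smul, smul_eq_zero, hK, false_or] at hd
  obtain ⟨hz1, hz2, hz3⟩ := coeff_eq_zero_of_oddDeriv_eq_zero (z₀ := f.coeff 0)
    (z₁ := -4 * Complex.I * (f.coeff 1 - Δ η κ 2 0 * f.coeff 0))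
    (z₂ := 4 * Complex.I * (f.coeff 1 + Δ η κ 1 0 * f.coeff 0))
    (z₃ := 16 * (f.coeff 1 + 2 * f.coeff 2 + f.coeff 1 * Δ η κ 1 0 - f.coeff 1 * Δ η κ 2 0 -
      f.coeff 0 * Δ η κ 2 0 * Δ η κ 1 0)) (by
    simp only [Algebra.smul_def, mul_zero, add_zero, mul_one, one_mul, map_neg, map_mul, map_sub,
      map_add, map_ofNat, ← hI, ← hp₁, ← hp₂]
    set F₀ := algebraMap ℂ Center (f.coeff 0)
    set F₁ := algebraMap ℂ Center (f.coeff 1)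
    set F₂ := algebraMap ℂ Center (f.coeff 2)
    set a := algebraMap ℂ Center (Δ η κ 1 0)
    set b := algebraMap ℂ Center (Δ η κ 2 0)
    linear_combination 16 * (a * b * F₀ - a * F₁ + b * F₁) * p₁ * p₂ * hII +
      (16 * F₁ * I ^ 2 * a + 64 * F₁ * I ^ 3 * a * b * p₁ + (16 * F₁ + 32 * F₂) * 4 * I * a * p₁ +
        (16 * F₁ + 32 * F₂) * 16 * I ^ 2 * a * b * p₁ ^ 2) * h₂ +
      (-16 * F₁ * I ^ 2 * b - 64 * F₁ * I ^ 3 * a * b * p₂ +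
        (16 * F₁ + 32 * F₂) * 4 * I * b * p₂) * h₁) hd
  have e1 : f.coeff 1 = Δ η κ 2 0 * f.coeff 0 := by
    simpa [Complex.I_ne_zero, sub_eq_zero] using hz1
  have e2 : f.coeff 1 = -Δ η κ 1 0 * f.coeff 0 := by
    have : f.coeff 1 + Δ η κ 1 0 * f.coeff 0 = 0 := by simpa [Complex.I_ne_zero] using hz2
    linear_combination this
  -- By `e1`, the two terms of `z₃` that contain `Δ₁₀` cancel.
  exact ⟨e1, e2, by linear_combination hz3 / 16 - (Δ η κ 1 0 : ℂ) * e1⟩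

/-- The substitution that keeps one component of `θbar_k`, makes `θ_l` proportional to one odd
coordinate and annihilates the other coordinates. -/
def chiralChart (x : Config) (k l : Fin 3) : Gen → Gen → ℂ :=
  Sum.elim (fun p => if p.1 = l then bodyMatrix k l x 0 p.2 • Pi.single (Sum.inl (l, 0)) 1 else 0)
    (fun p => if p = (k, 0) then Pi.single (Sum.inr (k, 0)) 1 else 0)

/-- The images of the products `θ_j^d θbar_i^c` under `chiralChart`. -/
def chiralPair (x : Config) (k l j : Fin 3) (d : Fin 2) (i : Fin 3) (c : Fin 2) : Center :=
  if j = l ∧ (i, c) = (k, 0) then bodyMatrix k l x 0 d • pair l 0 k 0 else 0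

lemma chiralChart_pair (x : Config) (k l j : Fin 3) (d : Fin 2) (i : Fin 3) (c : Fin 2) :
    ι ℂ (chiralChart x k l (Sum.inl (j, d))) * ι ℂ (chiralChart x k l (Sum.inr (i, c))) =
      (chiralPair x k l j d i c).val := by
  by_cases h1 : j = l <;> by_cases h2 : (i, c) = (k, 0) <;>
    simp [chiralChart, chiralPair, h1, h2, val_pair, θ, θbar]

/-- The nilpotent parts of the squares under `chiralChart`. -/
def chiralNil (k l i j : Fin 3) : Center :=
  if (i, j) = (k, l) then (-4 * Complex.I) • pair l 0 k 0 else 0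

/-- The chart multiplies row 0 of the body matrix of `(k, l)` by `1 + ε` and leaves the other row
unchanged, so the determinant acquires exactly this factor. -/
lemma chiral_substSq (x : Config) {k l : Fin 3} (hkl : k ≠ l) (i j : Fin 3) :
    substSq (chiralPair x k l) i j x =
      algebraMap ℂ Center (bodySq i j x) * (1 + chiralNil k l i j) := by
  have hd : ∀ i d c, chiralPair x k l i d i c = 0 := fun i d c => by
    rw [chiralPair, if_neg]
    rintro ⟨rfl, h⟩
    exact hkl (Prod.ext_iff.1 h).1.symm
  rw [substSq, Matrix.det_fin_two, ← det_bodyMatrix, Matrix.det_fin_two]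
  simp only [Matrix.of_apply, hd]
  by_cases h : (i, j) = (k, l)
  · obtain ⟨rfl, rfl⟩ := Prod.ext_iff.1 h
    simp [chiralPair, chiralNil, Algebra.smul_def]
    simp only [map_ofNat]
    ring
  · have h0 : ∀ d c, chiralPair x k l j d i c = 0 := fun d c => by
      rw [chiralPair, if_neg]
      rintro ⟨rfl, h'⟩
      exact h (Prod.ext (Prod.ext_iff.1 h').1 rfl)
    simp [h0, chiralNil, h]

/-- To first order `J1 = 1 + s ε`, where `s` is `1` or `-1` in the applications, as the square of
`(k, l)` stands in the numerator or the denominator of `J1`. The hypothesis `hs` isolates this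
bookkeeping so that both chiral points share one proof. -/
lemma chiral_coeffs {ℓ : Fin 3 → Fin 3 → Config → ℂ} {x : Config}
    (hL : IsLogAt x fun i j => ℓ i j x) {η κ : Fin 3 → ℝ} {f : PowerSeries ℂ} {k l : Fin 3}
    (hkl : k ≠ l) (s : ℂ) (hs : ∀ ε : Fin 3 → Fin 3 → Center,
      (∀ i j, (i, j) ≠ (k, l) → ε i j = 0) → ε k l * ε k l = 0 →
      (1 + s • ε k l) * ((1 + ε 1 0) * (1 + ε 0 2) * (1 + ε 2 1)) =
        (1 + ε 1 2) * (1 + ε 2 0) * (1 + ε 0 1) ∧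
      ∀ a : Fin 3 → Fin 3 → ℂ, (1 + a 0 1 • ε 0 1) * (1 + a 1 0 • ε 1 0) * (1 + a 0 2 • ε 0 2) *
        (1 + a 2 0 • ε 2 0) * (1 + a 1 2 • ε 1 2) * (1 + a 2 1 • ε 2 1) = 1 + a k l • ε k l)
    (h : covDbar k 0 (generalThreePoint ℓ η κ f) x = 0) :
    s * f.coeff 1 = Δ η κ k l * f.coeff 0 := by
  have hε : ∀ i j, chiralNil k l i j * chiralNil k l i j = 0 := fun i j => by
    rw [chiralNil]
    split_ifs <;> simp only [smul_mul_smul_comm, pair_mul_pair_of_same_bar, smul_zero, mul_zero]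
  obtain ⟨hJ, hp⟩ := hs (chiralNil k l) (fun i j hij => if_neg hij) (hε k l)
  obtain ⟨K, hK, hG⟩ := subst_generalThreePoint hL (w := chiralChart x k l) hε
    (fun i j hij => by rw [subst_centralSq (chiralChart_pair x k l), chiral_substSq x hkl]) hJ η κ f
  have hd : oddDeriv (Sum.inr (k, 0)) (subst (chiralChart x k l)
      (generalThreePoint ℓ η κ f x)) = 0 := by
    refine subst_covDbar (fun g' => ?_) (fun a => ?_) h
    · rcases g' with ⟨i, a⟩ | p
      · by_cases hi : i = l <;> simp [chiralChart, hi]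
      · by_cases hp : p = (k, 0) <;> simp [chiralChart, hp, eq_comm]
    · simp [chiralChart, hkl]
  have hprod := hp (fun i j => (-Δ η κ i j : ℂ))
  have hcube : (s • chiralNil k l k l) ^ 3 = 0 := by
    rw [pow_succ, pow_two, smul_mul_smul_comm, hε, smul_zero, zero_mul]
  rw [hprod, add_sub_cancel_left, taylorSum_eq_of_cube_eq_zero hcube, pow_two,
    smul_mul_smul_comm, hε, smul_zero, smul_zero, add_zero] at hG
  have hexp : (algebraMap ℂ Center (f.coeff 0) + f.coeff 1 • s • chiralNil k l k l) *
      (1 + (-Δ η κ k l : ℂ) • chiralNil k l k l) = algebraMap ℂ Center (f.coeff 0) +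
        (-4 * Complex.I * (s * f.coeff 1 - Δ η κ k l * f.coeff 0)) • pair l 0 k 0 := by
    have e : chiralNil k l k l = (-4 * Complex.I) • pair l 0 k 0 := if_pos rfl
    have h2 := hε k l
    rw [e] at h2 ⊢
    simp only [Algebra.smul_def, map_mul, map_sub, map_neg] at h2 ⊢
    linear_combination (- algebraMap ℂ Center (f.coeff 1) * algebraMap ℂ Center s *
      algebraMap ℂ Center (Δ η κ k l)) * h2
  rw [hexp] at hG
  rw [hG, map_smul, smul_eq_zero, or_iff_right hK] at hd
  have hd2 := congrArg (oddDeriv (Sum.inl (l, 0))) hd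
  simp [val_pair, oddDeriv_algebraMap, oddDeriv_θ_mul, oddDeriv_θ, oddDeriv_θbar,
    Complex.I_ne_zero, sub_eq_zero] at hd2
  rw [hd2, PowerSeries.coeff_zero_eq_constantCoeff_apply]

/-! ## Covariant derivatives of even central superfields -/

/-- The graded Leibniz rule: moving the derivative past `a` costs the sign of its parity. -/
lemma oddDeriv_mul (g : Gen) (a b : Grassmann) :
    oddDeriv g (a * b) = oddDeriv g a * b + CliffordAlgebra.involute a * oddDeriv g b := by
  induction a using CliffordAlgebra.left_induction with
  | algebraMap r =>
    rw [oddDeriv, CliffordAlgebra.contractLeft_algebraMap_mul, CliffordAlgebra.contractLeft_algebraMap,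
      zero_mul, zero_add, AlgHom.commutes]
  | add a a' h h' => simp only [add_mul, map_add, h, h']; abel
  | ι_mul a v h =>
    change oddDeriv g (ι ℂ v * a * b) = oddDeriv g (ι ℂ v * a) * b + _
    rw [mul_assoc, oddDeriv_ι_mul, oddDeriv_ι_mul, h, map_mul, CliffordAlgebra.involute_ι, sub_mul,
      smul_mul_assoc, mul_add, mul_assoc, neg_mul, neg_mul, mul_assoc]
    abel

instance : FiniteDimensional ℝ Grassmann :=
  have : FiniteDimensional ℂ Grassmann := Module.Finite.of_basis monomialBasis
  FiniteDimensional.complexToReal Grassmann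

/-- The product of the Grassmann algebra as a continuous bilinear map. -/
def mulBilin : Grassmann →L[ℝ] Grassmann →L[ℝ] Grassmann :=
  LinearMap.toContinuousBilinearMap (LinearMap.mk₂ ℝ (fun a b : Grassmann => a * b) add_mul
    (fun c a b => smul_mul_assoc (c : ℂ) a b) mul_add (fun c a b => mul_smul_comm (c : ℂ) a b))

lemma mulBilin_apply (a b : Grassmann) : mulBilin a b = a * b := rfl

/-- The operator `c ∂/∂g + ∑ k, ω_k ∂/∂v_k` on superfields. -/
def superDeriv {κ : Type*} [Fintype κ] (c : ℂ) (g : Gen) (ω : κ → Grassmann) (v : κ → Config)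
    (Φ : Superfield) (x : Config) : Grassmann :=
  c • oddDeriv g (Φ x) + ∑ k, ω k * fderiv ℝ Φ x (v k)

/-- The even central superfield `Φ` is differentiable at `x` and its derivative there under
`superDeriv c g ω v` is `r lam`. -/
structure HasSuperDeriv {κ : Type*} [Fintype κ] (c : ℂ) (g : Gen) (ω : κ → Grassmann)
    (v : κ → Config) (lam : Grassmann) (Φ : Config → Center) (x : Config) (r : Center) : Prop where
  differentiableAt : DifferentiableAt ℝ (fun y => (Φ y).val) x
  involute : CliffordAlgebra.involute (Φ x).val = (Φ x).val
  eq : superDeriv c g ω v (fun y => (Φ y).val) x = r.val * lam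

namespace HasSuperDeriv

variable {κ : Type*} [Fintype κ] {c : ℂ} {g : Gen} {ω : κ → Grassmann} {v : κ → Config}
  {lam : Grassmann} {Φ Ψ : Config → Center} {x : Config} {r s : Center}

lemma mul (h : HasSuperDeriv c g ω v lam Φ x r) (h' : HasSuperDeriv c g ω v lam Ψ x s) :
    HasSuperDeriv c g ω v lam (fun y => Φ y * Ψ y) x (r * Ψ x + Φ x * s) := by
  have hd := mulBilin.hasFDerivAt_of_bilinear h.differentiableAt.hasFDerivAt
    h'.differentiableAt.hasFDerivAt
  simp only [mulBilin_apply, ← map_mul] at hd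
  refine ⟨hd.differentiableAt, by rw [map_mul, map_mul, h.involute, h'.involute], ?_⟩
  have e1 := h.eq
  have e2 := h'.eq
  rw [superDeriv] at e1 e2 ⊢
  have hv : ∀ k, fderiv ℝ (fun y => (Φ y * Ψ y).val) x (v k) =
      (Φ x).val * fderiv ℝ (fun y => (Ψ y).val) x (v k) +
        fderiv ℝ (fun y => (Φ y).val) x (v k) * (Ψ x).val := fun k => by rw [hd.fderiv]; rfl
  rw [map_mul, oddDeriv_mul, h.involute, map_add, map_mul, map_mul, add_mul,
    mul_assoc, (Ψ x).comm lam, ← mul_assoc, ← e1, mul_assoc, ← e2]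
  simp only [hv, mul_add, add_mul, Finset.mul_sum,
    Finset.sum_mul, Finset.sum_add_distrib, smul_add, mul_smul_comm, smul_mul_assoc,
    Center.mul_left_comm, mul_assoc]
  abel

lemma add (h : HasSuperDeriv c g ω v lam Φ x r) (h' : HasSuperDeriv c g ω v lam Ψ x s) :
    HasSuperDeriv c g ω v lam (fun y => Φ y + Ψ y) x (r + s) := by
  have hd := h.differentiableAt.hasFDerivAt.add h'.differentiableAt.hasFDerivAt
  have hfun : (fun y => (Φ y + Ψ y).val) = (fun y => (Φ y).val) + fun y => (Ψ y).val := by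
    ext y; exact map_add _ _ _
  refine ⟨by rw [hfun]; exact hd.differentiableAt,
    by rw [map_add, map_add, h.involute, h'.involute], ?_⟩
  have e1 := h.eq
  have e2 := h'.eq
  rw [superDeriv] at e1 e2 ⊢
  rw [hfun, hd.fderiv, map_add, map_add, map_add, add_mul, ← e1, ← e2]
  simp only [add_apply, mul_add, Finset.sum_add_distrib, smul_add]
  abel

lemma ofScalar {z : Config → ℂ} {z' : Config →L[ℝ] ℂ} (hz : HasFDerivAt z z' x)
    (hr : ∑ k, z' (v k) • ω k = r.val * lam) :
    HasSuperDeriv c g ω v lam (fun y => algebraMap ℂ Center (z y)) x r := by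
  have hd := hz.smul_const (1 : Grassmann)
  have hfun : (fun y => (algebraMap ℂ Center (z y)).val) = fun y => z y • (1 : Grassmann) := by
    ext y; rw [AlgHom.commutes, Algebra.algebraMap_eq_smul_one]
  refine ⟨by rw [hfun]; exact hd.differentiableAt, by rw [AlgHom.commutes, AlgHom.commutes], ?_⟩
  rw [superDeriv, hfun, hd.fderiv, ← hr, AlgHom.commutes, oddDeriv_algebraMap, smul_zero, zero_add]
  simp only [ContinuousLinearMap.smulRight_apply, mul_smul_comm, mul_one]

lemma const (z : ℂ) : HasSuperDeriv c g ω v lam (fun _ => algebraMap ℂ Center z) x 0 :=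
  ofScalar (hasFDerivAt_const z x) (by simp)

lemma smul (z : ℂ) (h : HasSuperDeriv c g ω v lam Φ x r) :
    HasSuperDeriv c g ω v lam (fun y => z • Φ y) x (z • r) := by
  have := (const (c := c) (g := g) (ω := ω) (v := v) (lam := lam) (x := x) z).mul h
  simpa only [Algebra.smul_def, zero_mul, zero_add] using this

lemma pow (h : HasSuperDeriv c g ω v lam Φ x r) (n : ℕ) :
    HasSuperDeriv c g ω v lam (fun y => Φ y ^ n) x (n * Φ x ^ (n - 1) * r) := by
  induction n with
  | zero => simpa using const (c := c) (g := g) (ω := ω) (v := v) (lam := lam) (x := x) 1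
  | succ n ih =>
    have := ih.mul h
    simp only [← pow_succ] at this
    convert this using 1
    rcases n with _ | n
    · simp
    · simp only [Nat.add_sub_cancel]; push_cast; ring

lemma sum {τ : Type*} (t : Finset τ) {Φ : τ → Config → Center} {r : τ → Center}
    (h : ∀ i ∈ t, HasSuperDeriv c g ω v lam (Φ i) x (r i)) :
    HasSuperDeriv c g ω v lam (fun y => ∑ i ∈ t, Φ i y) x (∑ i ∈ t, r i) := by
  classical
  induction t using Finset.induction_on with
  | empty => simpa using const (c := c) (g := g) (ω := ω) (v := v) (lam := lam) (x := x) 0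
  | insert i t hi ih =>
    simp only [Finset.sum_insert hi]
    exact (h i (Finset.mem_insert_self i t)).add (ih fun j hj => h j (Finset.mem_insert_of_mem hj))

/-- A power of a superfield annihilated by an odd derivation is annihilated by it. -/
lemma complexPow {L : Config → ℂ} {L' : Config →L[ℝ] ℂ} (hL : HasFDerivAt L L' x)
    (h : HasSuperDeriv c g ω v (∑ k, L' (v k) • ω k) Φ x 0)
    (hN : HasLog nilIdeal (L x) (Φ x)) (a : ℂ) :
    HasSuperDeriv c g ω v (∑ k, L' (v k) • ω k) (fun y => complexPow (L y) a (Φ y)) x 0 := by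
  -- This is the derivative of `L` itself. Every derivative below is a central multiple of it, which
  -- reduces the claim to an identity in `Center`.
  set lam := ∑ k, L' (v k) • ω k with hlam
  have hexp : ∀ b : ℂ, HasSuperDeriv c g ω v lam
      (fun y => algebraMap ℂ Center (Complex.exp (b * L y))) x
      (algebraMap ℂ Center (Complex.exp (b * L x) * b)) := fun b => by
    refine ofScalar ((hL.const_mul b).cexp) ?_
    simp only [smul_apply, smul_eq_mul, hlam, AlgHom.commutes,
      ← Algebra.smul_def, Finset.smul_sum, smul_smul, mul_assoc]
  have hNd := ((hexp (-1)).mul h).add (const (-1))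
  set N : Config → Center := fun y =>
    algebraMap ℂ Center (Complex.exp (-1 * L y)) * Φ y + algebraMap ℂ Center (-1) with hNdef
  have hNx : N x ∈ nilIdeal := by
    have := hN
    rwa [HasLog, Algebra.smul_def, sub_eq_add_neg, ← map_one (algebraMap ℂ Center), ← map_neg,
      ← neg_one_mul (L x)] at this
  have hpow := (hexp a).mul (sum (Finset.range 13) fun k _ =>
    (hNd.pow k).smul ((choosePoly k).eval a))
  have hfun : (fun y => ThreePointSCFT.complexPow (L y) a (Φ y)) = fun y =>
      algebraMap ℂ Center (Complex.exp (a * L y)) *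
        ∑ k ∈ Finset.range 13, (choosePoly k).eval a • N y ^ k := by
    ext y
    simp only [ThreePointSCFT.complexPow, taylorSum, coeff_binomialSeries, hNdef, neg_one_mul, map_neg,
      map_one, Algebra.smul_def, sub_eq_add_neg]
  rw [hfun]
  convert hpow using 1
  -- As `Φ` is annihilated, the derivative of `N = exp (-L) Φ - 1` is `-(1 + N) lam`. The truncated
  -- form of `(1 + N) d/dN (1 + N) ^ a = a (1 + N) ^ a` telescopes and leaves one boundary term.
  have htel : ∀ n : ℕ, ∑ k ∈ Finset.range (n + 1), (choosePoly k).eval a •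
      (a • N x ^ k - k * N x ^ (k - 1) * (1 + N x)) =
        ((a - n) * (choosePoly n).eval a) • N x ^ n := fun n => by
    induction n with
    | zero => simp [choosePoly_zero]
    | succ n ih =>
      rw [Finset.sum_range_succ, ih, ← choosePoly_succ]
      simp only [Algebra.smul_def, map_mul, map_sub, map_add, map_natCast, map_one,
        Nat.add_sub_cancel, Nat.cast_succ]
      ring
  -- The boundary term contains `N ^ 12`, so `N ^ 13 = 0` alone would not suffice.
  have hz := htel 12
  rw [pow_eq_zero_of_le (show 7 ≤ 12 by norm_num) (pow_seven_eq_zero hNx), smul_zero] at hz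
  have hr : algebraMap ℂ Center (Complex.exp (-1 * L x) * -1) * Φ x +
      algebraMap ℂ Center (Complex.exp (-1 * L x)) * 0 + 0 = -(1 + N x) := by
    simp only [hNdef, map_mul, map_neg, map_one]; ring
  symm
  rw [hr, map_mul, mul_assoc, ← mul_add, ← mul_zero (algebraMap ℂ Center (Complex.exp (a * L x))),
    ← hz, Finset.mul_sum, ← Finset.sum_add_distrib]
  congr 1
  refine Finset.sum_congr rfl fun k _ => ?_
  simp only [Algebra.smul_def]
  ring

end HasSuperDeriv

/-! ## Chirality of the intervals -/

lemma involute_val_pair (j : Fin 3) (d : Fin 2) (i : Fin 3) (c : Fin 2) :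
    CliffordAlgebra.involute (pair j d i c).val = (pair j d i c).val := by
  rw [val_pair, map_mul, θ, θbar, CliffordAlgebra.involute_ι, CliffordAlgebra.involute_ι, neg_mul_neg]

section

variable {κ : Type*} [Fintype κ] {c : ℂ} {g : Gen} {ω : κ → Grassmann} {v : κ → Config}
  {lam lam' : Grassmann} {x : Config}

/-- A vanishing derivative is a multiple of any odd element. This permits combining powers whose
logarithms have different derivatives. -/
lemma HasSuperDeriv.of_zero {Φ : Config → Center} (h : HasSuperDeriv c g ω v lam Φ x 0) :
    HasSuperDeriv c g ω v lam' Φ x 0 :=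
  ⟨h.differentiableAt, h.involute, by rw [h.eq, map_zero, zero_mul, zero_mul]⟩

/-- The coordinate difference `x_i^μ - x_j^μ` as a linear function. -/
def differenceCLM (i j : Fin 3) (μ : Fin 4) : Config →L[ℝ] ℂ :=
  Complex.ofRealCLM.comp ((ContinuousLinearMap.proj (R := ℝ) (φ := fun _ : Fin 4 => ℝ) μ).comp
    (ContinuousLinearMap.proj (R := ℝ) (φ := fun _ : Fin 3 => Fin 4 → ℝ) i -
      ContinuousLinearMap.proj (R := ℝ) (φ := fun _ : Fin 3 => Fin 4 → ℝ) j))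

lemma differenceCLM_apply (i j : Fin 3) (μ : Fin 4) (y : Config) :
    differenceCLM i j μ y = ((y i μ - y j μ : ℝ) : ℂ) := rfl

/-- The nilpotent part of an interval. -/
def intervalSoul (i j : Fin 3) (μ : Fin 4) : Center :=
  Complex.I • ∑ a, ∑ b, pauli μ a b • (pair i a i b + pair j a j b - 2 * pair j a i b)

lemma hasSuperDeriv_centralInterval {i j : Fin 3} {μ : Fin 4}
    (h : c • oddDeriv g (intervalSoul i j μ).val + ∑ k, ((v k i μ - v k j μ : ℝ) : ℂ) • ω k = 0) :
    HasSuperDeriv c g ω v lam (fun y => centralInterval i j μ y) x 0 := by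
  have hz : HasFDerivAt (fun y => differenceCLM i j μ y) (differenceCLM i j μ) x :=
    (differenceCLM i j μ).hasFDerivAt
  have hd := (hz.smul_const (1 : Grassmann)).add_const (intervalSoul i j μ).val
  have hfun : (fun y => (centralInterval i j μ y).val) =
      fun y => differenceCLM i j μ y • (1 : Grassmann) + (intervalSoul i j μ).val := by
    ext y
    rw [centralInterval, intervalSoul, map_add, AlgHom.commutes, Algebra.algebraMap_eq_smul_one,
      differenceCLM_apply]
  refine ⟨by rw [hfun]; exact hd.differentiableAt, ?_, ?_⟩
  · simp only [centralInterval, map_add, map_sub, map_smul, map_sum, map_mul, map_ofNat,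
      involute_val_pair, AlgHom.commutes]
  · have hval : (centralInterval i j μ x).val =
        algebraMap ℂ Grassmann ((x i μ - x j μ : ℝ) : ℂ) + (intervalSoul i j μ).val := by
      rw [centralInterval, intervalSoul, map_add, AlgHom.commutes]
    rw [superDeriv, hval, hfun, hd.fderiv, map_zero, zero_mul, ← h, map_add, oddDeriv_algebraMap,
      zero_add]
    congr 1
    refine Finset.sum_congr rfl fun k _ => ?_
    rw [ContinuousLinearMap.smulRight_apply, mul_smul_comm, mul_one]
    rfl

lemma hasSuperDeriv_centralSq {i j : Fin 3}
    (h : ∀ μ, c • oddDeriv g (intervalSoul i j μ).val +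
      ∑ k, ((v k i μ - v k j μ : ℝ) : ℂ) • ω k = 0) :
    HasSuperDeriv c g ω v lam (centralSq i j) x 0 := by
  have hfun : centralSq i j = fun y =>
      ∑ μ, minkowski μ • (centralInterval i j μ y * centralInterval i j μ y) := by
    ext1 y
    rw [centralSq, intervalMatrix_eq, det_sum_pauli]
  rw [hfun]
  have := HasSuperDeriv.sum (c := c) (g := g) (ω := ω) (v := v) (lam := lam) (x := x) Finset.univ
    fun μ _ => ((hasSuperDeriv_centralInterval (x := x) (lam := lam) (h μ)).mul
      (hasSuperDeriv_centralInterval (h μ))).smul (minkowski μ)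
  simpa using this

end

lemma covD_eq_superDeriv (i : Fin 3) (a : Fin 2) (Φ : Superfield) (x : Config) :
    covD i a Φ x = superDeriv 1 (Sum.inl (i, a))
      (fun k : Fin 4 × Fin 2 => -(Complex.I • pauli k.1 a k.2 • θbar i k.2))
      (fun k => Pi.single i (Pi.single k.1 1)) Φ x := by
  simp only [covD, superDeriv, Fintype.sum_prod_type, one_smul, neg_mul, Finset.sum_neg_distrib,
    smul_mul_assoc, ← Finset.smul_sum, sub_eq_add_neg, evenDeriv]

lemma covDbar_eq_superDeriv (i : Fin 3) (b : Fin 2) (Φ : Superfield) (x : Config) :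
    covDbar i b Φ x = superDeriv (-1) (Sum.inr (i, b))
      (fun k : Fin 4 × Fin 2 => Complex.I • pauli k.1 k.2 b • θ i k.2)
      (fun k => Pi.single i (Pi.single k.1 1)) Φ x := by
  simp only [covDbar, superDeriv, Fintype.sum_prod_type, neg_smul, one_smul,
    smul_mul_assoc, ← Finset.smul_sum, evenDeriv]

lemma sum_single_smul {S : Type*} [AddCommGroup S] [Module ℂ S] {i j : Fin 3} (k : Fin 3)
    (μ : Fin 4) (ω : Fin 4 × Fin 2 → S) :
    ∑ p : Fin 4 × Fin 2, (((Pi.single k (Pi.single p.1 1) : Config) i μ -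
      (Pi.single k (Pi.single p.1 1) : Config) j μ : ℝ) : ℂ) • ω p =
      ((if i = k then 1 else 0) - (if j = k then 1 else 0) : ℂ) • ∑ b, ω (μ, b) := by
  rw [Fintype.sum_prod_type, Finset.sum_eq_single μ]
  · rw [Finset.smul_sum]
    refine Finset.sum_congr rfl fun b _ => ?_
    congr 1
    by_cases h1 : i = k <;> by_cases h2 : j = k <;> simp [h1, h2]
  · intro ν _ hν
    refine Finset.sum_eq_zero fun b _ => ?_
    by_cases h1 : i = k <;> by_cases h2 : j = k <;> simp [h1, h2, hν.symm]
  · simp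

lemma covD_intervalSoul {j : Fin 3} (hj : j ≠ 0) (a : Fin 2) (μ : Fin 4) :
    (1 : ℂ) • oddDeriv (Sum.inl (0, a)) (intervalSoul 0 j μ).val +
      ∑ k : Fin 4 × Fin 2, (((Pi.single 0 (Pi.single k.1 1) : Config) 0 μ -
        (Pi.single 0 (Pi.single k.1 1) : Config) j μ : ℝ) : ℂ) •
          (-(Complex.I • pauli k.1 a k.2 • θbar 0 k.2)) = 0 := by
  rw [sum_single_smul]
  simp only [intervalSoul, map_smul, map_sum, map_add, map_sub, two_mul, val_pair, oddDeriv_θ_mul,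
    oddDeriv_θbar]
  fin_cases a <;> simp [hj, hj.symm, Fin.sum_univ_two]

/-- If `j = i`, the derivatives of `x_j` and of `θ_j σ θbar_j` cancel. Otherwise the interval does
not depend on point `i`. -/
lemma covDbar_intervalSoul {i j : Fin 3} (hi : i ≠ 0) (b : Fin 2) (μ : Fin 4) :
    (-1 : ℂ) • oddDeriv (Sum.inr (i, b)) (intervalSoul 0 j μ).val +
      ∑ k : Fin 4 × Fin 2, (((Pi.single i (Pi.single k.1 1) : Config) 0 μ -
        (Pi.single i (Pi.single k.1 1) : Config) j μ : ℝ) : ℂ) •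
          (Complex.I • pauli k.1 k.2 b • θ i k.2) = 0 := by
  rw [sum_single_smul]
  simp only [intervalSoul, map_smul, map_sum, map_add, map_sub, two_mul, val_pair, oddDeriv_θ_mul,
    oddDeriv_θbar]
  by_cases hij : j = i
  · subst hij
    fin_cases b <;> simp [hi, hi.symm, Fin.sum_univ_two]
  · fin_cases b <;> simp [hi, hi.symm, hij, Ne.symm hij, eq_comm, Fin.sum_univ_two]

/-! ## Differentiability of the logarithms -/

lemma differentiable_bodySq (i j : Fin 3) : Differentiable ℝ (bodySq i j) := by
  have h : ∀ μ : Fin 4, Differentiable ℝ fun y : Config => ((y i μ - y j μ : ℝ) : ℂ) := fun μ =>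
    (differenceCLM i j μ).differentiable
  unfold bodySq
  fun_prop

/-- Near `x` the continuous branch changes its imaginary part by less than `π`, so it is a constant
plus the principal logarithm of a ratio of squares close to 1. -/
lemma differentiableAt_log_branch {U : Set Config} (hU : IsOpen U)
    {ℓ : Fin 3 → Fin 3 → Config → ℂ} (hℓ : IsLogBranch U ℓ) {i j : Fin 3} (hij : i ≠ j)
    {x : Config} (hx : x ∈ U) : DifferentiableAt ℝ (ℓ i j) x := by
  have hne : bodySq i j x ≠ 0 := by
    rw [← hℓ.exp_eq i j hij x hx]; exact Complex.exp_ne_zero _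
  have hcont : ContinuousAt (ℓ i j) x := (hℓ.continuousOn i j hij).continuousAt (hU.mem_nhds hx)
  have him : ∀ᶠ y in nhds x, |(ℓ i j y - ℓ i j x).im| < Real.pi := by
    have : ContinuousAt (fun y => |(ℓ i j y - ℓ i j x).im|) x :=
      (Complex.continuous_im.continuousAt.comp (hcont.sub continuousAt_const)).abs
    refine this.eventually (gt_mem_nhds ?_)
    simpa using Real.pi_pos
  have heq : ℓ i j =ᶠ[nhds x] fun y => ℓ i j x + Complex.log (bodySq i j y / bodySq i j x) := by
    filter_upwards [him, hU.mem_nhds hx] with y hy hyU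
    rw [← hℓ.exp_eq i j hij x hx, ← hℓ.exp_eq i j hij y hyU, ← Complex.exp_sub,
      Complex.log_exp (abs_lt.1 hy).1 (abs_lt.1 hy).2.le]
    ring
  refine DifferentiableAt.congr_of_eventuallyEq ?_ heq
  refine DifferentiableAt.const_add _ ?_
  have hlog : DifferentiableAt ℝ Complex.log (bodySq i j x / bodySq i j x) :=
    (Complex.differentiableAt_log (by rw [div_self hne]; exact Complex.one_mem_slitPlane)
      ).restrictScalars ℝ
  exact hlog.comp x (((differentiable_bodySq i j) x).mul_const _)

/-! ## The main theorem -/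

section

variable {U : Set Config} {ℓ : Fin 3 → Fin 3 → Config → ℂ}

lemma superDeriv_chiralThreePoint {κ : Type*} [Fintype κ] {c : ℂ} {g : Gen} {ω : κ → Grassmann}
    {v : κ → Config} (hU : IsOpen U) (hℓ : IsLogBranch U ℓ)
    (h : ∀ j, j ≠ 0 → ∀ μ, c • oddDeriv g (intervalSoul 0 j μ).val +
      ∑ k, ((v k 0 μ - v k j μ : ℝ) : ℂ) • ω k = 0)
    {G : Superfield} {C : ℂ} {η : Fin 3 → ℝ}
    (hG : ∀ x ∈ U, G x = C • chiralThreePoint ℓ η x) {x : Config} (hx : x ∈ U) :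
    superDeriv c g ω v G x = 0 := by
  have hpow : ∀ j, j ≠ 0 → ∀ a : ℂ, HasSuperDeriv c g ω v 0
      (fun y => complexPow (ℓ 0 j y) a (centralSq 0 j y)) x 0 := fun j hj a =>
    (HasSuperDeriv.complexPow (differentiableAt_log_branch hU hℓ hj.symm hx).hasFDerivAt
      (hasSuperDeriv_centralSq (h j hj)) ((hℓ.isLogAt hx).hasLog hj.symm) a).of_zero
  have hd := ((hpow 1 (by decide) (-η 1 : ℂ)).mul (hpow 2 (by decide) (-η 2 : ℂ))).smul C
  have heq : G =ᶠ[nhds x] fun y => (C • (complexPow (ℓ 0 1 y) (-η 1 : ℂ) (centralSq 0 1 y) *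
      complexPow (ℓ 0 2 y) (-η 2 : ℂ) (centralSq 0 2 y))).val := by
    filter_upwards [hU.mem_nhds hx] with y hy
    rw [hG y hy, chiralThreePoint_eq (hℓ.isLogAt hy), map_smul]
    rfl
  have := hd.eq
  rw [mul_zero] at this
  rw [← this, superDeriv, superDeriv, heq.fderiv_eq, heq.eq_of_nhds]

lemma isChiralOn_of_eq (hU : IsOpen U) (hℓ : IsLogBranch U ℓ) {G : Superfield} {C : ℂ}
    {η : Fin 3 → ℝ} (hG : ∀ x ∈ U, G x = C • chiralThreePoint ℓ η x) : IsChiralOn U G := by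
  intro x hx s
  refine ⟨?_, ?_, ?_⟩
  · rw [covD_eq_superDeriv]
    exact superDeriv_chiralThreePoint hU hℓ (fun j hj μ => covD_intervalSoul hj s μ) hG hx
  · rw [covDbar_eq_superDeriv]
    exact superDeriv_chiralThreePoint hU hℓ
      (fun j _ μ => covDbar_intervalSoul (by decide) s μ) hG hx
  · rw [covDbar_eq_superDeriv]
    exact superDeriv_chiralThreePoint hU hℓ
      (fun j _ μ => covDbar_intervalSoul (by decide) s μ) hG hx

end

lemma chiral_coeffs_one_two {ℓ : Fin 3 → Fin 3 → Config → ℂ} {x : Config}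
    (hL : IsLogAt x fun i j => ℓ i j x) {η κ : Fin 3 → ℝ} {f : PowerSeries ℂ}
    (h : covDbar 1 0 (generalThreePoint ℓ η κ f) x = 0) :
    f.coeff 1 = Δ η κ 1 2 * f.coeff 0 := by
  have := chiral_coeffs hL (k := 1) (l := 2) (by decide) 1 (fun ε hε _ => ?_) h
  · simpa using this
  · simp [hε 0 1 (by decide), hε 1 0 (by decide), hε 0 2 (by decide), hε 2 0 (by decide),
      hε 2 1 (by decide)]

lemma chiral_coeffs_two_one {ℓ : Fin 3 → Fin 3 → Config → ℂ} {x : Config}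
    (hL : IsLogAt x fun i j => ℓ i j x) {η κ : Fin 3 → ℝ} {f : PowerSeries ℂ}
    (h : covDbar 2 0 (generalThreePoint ℓ η κ f) x = 0) :
    f.coeff 1 = -Δ η κ 2 1 * f.coeff 0 := by
  have := chiral_coeffs hL (k := 2) (l := 1) (by decide) (-1) (fun ε hε hsq => ?_) h
  · linear_combination -this
  · simp only [hε 0 1 (by decide), hε 1 0 (by decide), hε 0 2 (by decide), hε 2 0 (by decide),
      hε 1 2 (by decide), smul_zero, add_zero, mul_one, one_mul, neg_smul, one_smul, implies_true,
      and_true]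
    linear_combination -hsq

/-- Only three coefficients count, and the hypotheses are the first two steps of the recursion for
binomial coefficients. -/
lemma taylorSum_eq_smul_complexPow {A : Type*} [CommRing A] [Algebra ℂ A] {J : A}
    (hJ : (J - 1) ^ 3 = 0) {f : PowerSeries ℂ} {a : ℂ} (h1 : f.coeff 1 = a * f.coeff 0)
    (h2 : 2 * f.coeff 2 = (a - 1) * f.coeff 1) :
    taylorSum f (J - 1) = f.coeff 0 • complexPow 0 a J := by
  have h2' : f.coeff 2 = f.coeff 0 * (a * (a - 1) / 2) := by
    rw [h1] at h2
    linear_combination h2 / 2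
  rw [complexPow, neg_zero, mul_zero, Complex.exp_zero, one_smul, one_smul,
    taylorSum_eq_of_cube_eq_zero hJ, taylorSum_eq_of_cube_eq_zero hJ, coeff_binomialSeries,
    coeff_binomialSeries, coeff_binomialSeries, choosePoly_zero, choosePoly_one, choosePoly_two,
    h1, h2', smul_add, smul_add, smul_smul, smul_smul, mul_comm a, map_one,
    Algebra.algebraMap_eq_smul_one]

/-- The charges of a chiral three-point function are determined by the exponents. -/
lemma chiralCharges_of_exponents {η κ : Fin 3 → ℝ} (hκ : ∑ i, κ i = 0)
    (h20 : Δ η κ 2 0 = -Δ η κ 1 0) (h12 : Δ η κ 1 2 = -Δ η κ 1 0) (h21 : Δ η κ 2 1 = Δ η κ 1 0) :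
    ChiralCharges η κ := by
  simp only [Δ, Fin.sum_univ_three] at *
  refine ⟨?_, ?_, ?_⟩ <;> linarith

lemma ChiralCharges.eta_eq {η κ : Fin 3 → ℝ} (hκ : ∑ i, κ i = 0) (h : ChiralCharges η κ) :
    η 0 = η 1 + η 2 := by
  obtain ⟨h0, h1, h2⟩ := h
  rw [Fin.sum_univ_three] at hκ
  linarith

end ThreePointSCFT

end

open ThreePointSCFT in
theorem mainTheorem4
    (U : Set Config) (hUo : IsOpen U) (hUne : U.Nonempty)
    (ℓ : Fin 3 → Fin 3 → Config → ℂ) (hℓ : IsLogBranch U ℓ)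
    (η κ : Fin 3 → ℝ) (hκ : ∑ i, κ i = 0) (f : PowerSeries ℂ) :
    (ChiralCharges η κ → η 0 = η 1 + η 2) ∧
    (IsChiralOn U (generalThreePoint ℓ η κ f) ↔
      ∃ C : ℂ,
        (∀ x ∈ U, taylorEval f (I3PF x) = C • gpow 0 (-Δ η κ 1 0) (I3PF x + 1)) ∧
        (∀ x ∈ U, generalThreePoint ℓ η κ f x = C • chiralThreePoint ℓ η x) ∧
        (C ≠ 0 → ChiralCharges η κ)) := by
  refine ⟨fun h => h.eta_eq hκ, fun h => ?_, fun ⟨C, _, hG, _⟩ => isChiralOn_of_eq hUo hℓ hG⟩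
  have hcoef : ∀ x ∈ U, _ := fun x hx => antichiral_coeffs (hℓ.isLogAt hx) fun s => (h x hx s).1
  obtain ⟨x₀, hx₀⟩ := hUne
  obtain ⟨h20, h10, h2⟩ := hcoef x₀ hx₀
  have h12 := chiral_coeffs_one_two (hℓ.isLogAt hx₀) (h x₀ hx₀ 0).2.1
  have h21 := chiral_coeffs_two_one (hℓ.isLogAt hx₀) (h x₀ hx₀ 0).2.2
  have hrel : f.coeff 0 ≠ 0 → Δ η κ 2 0 = -Δ η κ 1 0 ∧ Δ η κ 1 2 = -Δ η κ 1 0 ∧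
      Δ η κ 2 1 = Δ η κ 1 0 := fun h0 => by
    rw [h10] at h20 h12 h21
    have e20 := mul_right_cancel₀ h0 h20
    have e12 := mul_right_cancel₀ h0 h12
    have e21 := neg_injective (mul_right_cancel₀ h0 h21)
    exact ⟨by exact_mod_cast e20.symm, by exact_mod_cast e12.symm, by exact_mod_cast e21.symm⟩
  have hsum : ∀ x ∈ U, taylorSum f (centralJ x - 1) =
      f.coeff 0 • complexPow 0 (-Δ η κ 1 0 : ℂ) (centralJ x) := fun x hx =>
    taylorSum_eq_smul_complexPow (hℓ.isLogAt hx).centralJ_sub_one_cube h10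
      -- The relations `h10` and `h20` give `(Δ₂₀ + Δ₁₀) f₁ = 0` without dividing by `f₀`, so the
      -- case `f₀ = 0` is included.
      (by linear_combination h2 + (Δ η κ 2 0 : ℂ) * h10 + (Δ η κ 1 0 : ℂ) * h20)
  refine ⟨f.coeff 0, fun x hx => ?_, fun x hx => ?_, fun h0 => ?_⟩
  · rw [taylorEval_eq, gpow_eq, ← (hℓ.isLogAt hx).val_centralJ_sub_one, ← map_one Center.val,
      ← map_add, sub_add_cancel, ← map_taylorSum, ← map_complexPow, ← map_smul, hsum x hx]
  · rw [generalThreePoint_eq (hℓ.isLogAt hx), hsum x hx, smul_mul_assoc, map_smul]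
    -- If `f₀ = 0`, both sides vanish and the charges remain unconstrained. Otherwise the charges
    -- are chiral, and they give `Δ₀₁ + Δ₁₀ = η₁` and `Δ₀₂ - Δ₁₀ = η₂`.
    by_cases h0 : f.coeff 0 = 0
    · rw [h0, zero_smul, zero_smul]
    · obtain ⟨r20, r12, r21⟩ := hrel h0
      obtain ⟨c0, c1, c2⟩ := chiralCharges_of_exponents hκ r20 r12 r21
      have hη := ChiralCharges.eta_eq hκ ⟨c0, c1, c2⟩
      rw [complexPow_centralJ_mul_prefactor (hℓ.isLogAt hx) r20 r12 r21]
      all_goals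
        simp only [Δ, Fin.sum_univ_three]
        linarith
  · obtain ⟨r20, r12, r21⟩ := hrel h0
    exact chiralCharges_of_exponents hκ r20 r12 r21
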